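/- Let $M$ be a Riemann surface with complex structure $I$, let $m_0\in M$, and let $(g,\nabla)$ be an (affine) special Kähler structure on $M\setminus\{m_0\}$: $g$ is a smooth Riemannian metric with $g(I\cdot,I\cdot)=g$, and $\nabla$ is a smooth connection on the real tangent bundle which is flat, torsion-free, preserves the Kähler form $\omega(\cdot,\cdot)=g(I\cdot,\cdot)$, and satisfies $(\nabla_XI)Y=(\nabla_YI)X$ for all vector fields $X,Y$. Let $z=x+iy$ be a local holomorphic coordinate near $m_0$ with $z(m_0)=0$, put $r=|z|$, and write $g=w\,|dz|^2$. Assume that the holomorphic cubic form $\Xi=-\omega(\pi^{(1,0)},\nabla\pi^{(1,0)})$, where $\pi^{(1,0)}$ is the projection onto the vectors of type $(1,0)$, has a finite order $n\in\mathbb Z$ at $m_0$, that is, $\Xi=\Xi_0\,dz^3$ with $\Xi_0$ meromorphic at $0$ of order exactly $n$. Assume that, as $z\to 0$, one of the following holds for a real number $\beta$ and a constant $C>0$: - (conical singularity of order $\tfrac12\beta$) $\beta<n+1$ and $w=r^{\beta}(C+o(1))$; - (logarithmic singularity of order $\tfrac12(n+1)$) $\beta=n+1$ and $w=-r^{n+1}\log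 r\,(C+o(1))$. Let $\gamma$ be a circle centered at the origin of the coordinate $z$, traversed once counterclockwise, such that the closed disc bounded by it lies in the image of the coordinate, and let $\mathrm{Hol}$ be the holonomy of $\nabla$ along $\gamma$ (with any base point on $\gamma$), written as a matrix in the frame $(\partial_x,\partial_y)$. Conjugacy is meant in $\mathrm{GL}(2,\mathbb R)$. Then: - if $\beta\notin\mathbb Z$, then $\mathrm{Hol}$ is conjugate to $\begin{pmatrix}\cos\pi\beta&-\sin\pi\beta\\ \sin\pi\beta&\cos\pi\beta\end{pmatrix}$; - if $\beta\in2\mathbb Z$, then $\mathrm{Hol}=\mathbf 1$ or $\mathrm{Hol}$ is conjugate to $\begin{pmatrix}1&1\\0&1\end{pmatrix}$; - if $\beta\in2\mathbb Z+1$, then $\mathrm{Hol}=-\mathbf 1$ or $\mathrm{Hol}$ is conjugate to $\begin{pmatrix}-1&1\\0&-1\end{pmatrix}$. Moreover, if the singularity is conical and $\beta\in\mathbb Z$, then $\mathrm{Hol}=\mathbf 1$ if $\beta$ is even and $\mathrm{Hol}=-\mathbf 1$ if $\beta$ is odd. -/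

import Mathlib

open Set Filter Topology
open scoped Manifold ContDiff Matrix

/-- The real smooth structure underlying a complex-analytic curve. -/
instance instIsManifoldRealOfComplex {M : Type*} [TopologicalSpace M] [ChartedSpace ℂ M]
    [IsManifold 𝓘(ℂ) ω M] : IsManifold 𝓘(ℝ, ℂ) ω M := by
  refine isManifold_of_contDiffOn 𝓘(ℝ, ℂ) ω M fun e e' he he' => ?_
  have h := (contDiffGroupoid ω 𝓘(ℂ)).compatible he he'
  have h' := (contDiffGroupoid ω 𝓘(ℂ)).mem_of_eqOnSource h (Setoid.refl _)
  rw [contDiffGroupoid, mem_groupoid_of_pregroupoid] at h'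
  exact h'.1.restrict_scalars ℝ

noncomputable section

/-- The real tangent space at a point of a Riemann surface. -/
abbrev RTangent {M : Type*} [TopologicalSpace M] [ChartedSpace ℂ M] (x : M) : Type :=
  TangentSpace 𝓘(ℝ, ℂ) x

/-- The complex structure `I` on the real tangent spaces of a Riemann surface. In Mathlib the
tangent space at `x` is identified with `ℂ` through the preferred (holomorphic) chart at `x`;
as holomorphic transition maps have `ℂ`-linear differentials, multiplication by `i` does not
depend on the chart. -/
def cxStr {M : Type*} [TopologicalSpace M] [ChartedSpace ℂ M] (x : M) :
    RTangent x →L[ℝ] RTangent x :=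
  (Complex.I • ContinuousLinearMap.id ℝ ℂ : ℂ →L[ℝ] ℂ)

/-- The vector field `X` is differentiable at `x`. -/
def VecDiffAt {M : Type*} [TopologicalSpace M] [ChartedSpace ℂ M]
    [IsManifold 𝓘(ℂ) ω M] (X : (x : M) → RTangent x) (x : M) : Prop :=
  MDifferentiableAt 𝓘(ℝ, ℂ) (𝓘(ℝ, ℂ).prod 𝓘(ℝ, ℂ))
    (fun y => (⟨y, X y⟩ : TangentBundle 𝓘(ℝ, ℂ) M)) x

/-- The vector field `X` is smooth at `x`. -/
def VecSmoothAt {M : Type*} [TopologicalSpace M] [ChartedSpace ℂ M]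
    [IsManifold 𝓘(ℂ) ω M] (X : (x : M) → RTangent x) (x : M) : Prop :=
  ContMDiffAt 𝓘(ℝ, ℂ) (𝓘(ℝ, ℂ).prod 𝓘(ℝ, ℂ)) ∞
    (fun y => (⟨y, X y⟩ : TangentBundle 𝓘(ℝ, ℂ) M)) x

/-- An (affine) special Kähler structure `(g, I, ω, ∇)` on the open subset `U` of a Riemann
surface. Vector fields are total functions on `M`; the values of `metric` and `conn` off `U`
are irrelevant. `conn Y x v` is `∇_v Y` at `x`. The Kähler form is `ω(v, w) = g(I v, w)`;
it is automatically closed in real dimension two. -/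
structure SpecialKahlerOn (M : Type*) [TopologicalSpace M] [ChartedSpace ℂ M]
    [IsManifold 𝓘(ℂ) ω M] (U : Set M) where
  /-- the Riemannian metric `g` -/
  metric : (x : M) → RTangent x →L[ℝ] RTangent x →L[ℝ] ℝ
  /-- the connection `∇` on the tangent bundle -/
  conn : ((x : M) → RTangent x) → (x : M) → RTangent x →L[ℝ] RTangent x
  metric_symm : ∀ x ∈ U, ∀ v w, metric x v w = metric x w v
  metric_pos : ∀ x ∈ U, ∀ v, v ≠ 0 → 0 < metric x v v
  metric_hermitian : ∀ x ∈ U, ∀ v w, metric x (cxStr x v) (cxStr x w) = metric x v w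
  metric_smooth : ContMDiffOn 𝓘(ℝ, ℂ) (𝓘(ℝ, ℂ).prod 𝓘(ℝ, ℂ →L[ℝ] ℂ →L[ℝ] ℝ)) ∞
    (fun x => Bundle.TotalSpace.mk' (ℂ →L[ℝ] ℂ →L[ℝ] ℝ)
      (E := fun x : M => RTangent x →L[ℝ] RTangent x →L[ℝ] ℝ) x (metric x)) U
  conn_isCovariantDerivative :
    IsCovariantDerivativeOn (I := 𝓘(ℝ, ℂ)) (V := fun x : M => RTangent x) ℂ conn U
  conn_smooth :
    ContMDiffCovariantDerivativeOn (I := 𝓘(ℝ, ℂ)) (V := fun x : M => RTangent x) ℂ ∞ conn U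
  /-- `∇_X Y - ∇_Y X = [X, Y]` -/
  torsion_free : ∀ x ∈ U, ∀ X Y : (x : M) → RTangent x,
    VecDiffAt X x → VecDiffAt Y x →
      conn Y x (X x) - conn X x (Y x) = VectorField.mlieBracket 𝓘(ℝ, ℂ) X Y x
  /-- `∇_X ∇_Y Z - ∇_Y ∇_X Z = ∇_[X, Y] Z` -/
  flat : ∀ x ∈ U, ∀ X Y Z : (x : M) → RTangent x,
    VecSmoothAt X x → VecSmoothAt Y x → VecSmoothAt Z x →
      conn (fun y => conn Z y (Y y)) x (X x) - conn (fun y => conn Z y (X y)) x (Y x)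
        = conn Z x (VectorField.mlieBracket 𝓘(ℝ, ℂ) X Y x)
  /-- `∇ω = 0`, that is `v(ω(Y, Z)) = ω(∇_v Y, Z) + ω(Y, ∇_v Z)` -/
  symplectic : ∀ x ∈ U, ∀ Y Z : (x : M) → RTangent x,
    VecDiffAt Y x → VecDiffAt Z x → ∀ v : RTangent x,
      mvfderiv 𝓘(ℝ, ℂ) (fun y => metric y (cxStr y (Y y)) (Z y)) x v
        = metric x (cxStr x (conn Y x v)) (Z x) + metric x (cxStr x (Y x)) (conn Z x v)
  /-- `(∇_X I) Y = (∇_Y I) X`, where `(∇_X I) Y = ∇_X (I Y) - I (∇_X Y)` -/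
  special : ∀ x ∈ U, ∀ X Y : (x : M) → RTangent x,
    VecDiffAt X x → VecDiffAt Y x →
      conn (fun y => cxStr y (Y y)) x (X x) - cxStr x (conn Y x (X x))
        = conn (fun y => cxStr y (X y)) x (Y x) - cxStr x (conn X x (Y x))

/-- The projection `π^{(1,0)} v = (v - i I v) / 2`. The complexified tangent space is written as
`T × T`, the pair `(a, b)` standing for `a + i b`. -/
def piOneZero {M : Type*} [TopologicalSpace M] [ChartedSpace ℂ M] (x : M) (v : RTangent x) :
    RTangent x × RTangent x :=
  ((1 / 2 : ℝ) • v, (-1 / 2 : ℝ) • cxStr x v)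

/-- The real vector field with constant coordinates `u` in the local coordinate `z`; so
`coordField z 1 = ∂/∂x` and `coordField z i = ∂/∂y`. -/
def coordField {M : Type*} [TopologicalSpace M] [ChartedSpace ℂ M]
    (z : OpenPartialHomeomorph M ℂ) (u : ℂ) (p : M) : RTangent p :=
  (mfderiv 𝓘(ℝ, ℂ) 𝓘(ℝ, ℂ) z p).inverse u

namespace SpecialKahlerOn

variable {M : Type*} [TopologicalSpace M] [ChartedSpace ℂ M] [IsManifold 𝓘(ℂ) ω M] {U : Set M}

/-- The Kähler form `ω(v, w) = g(I v, w)`, extended complex bilinearly to `T ⊗ ℂ`. -/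
def kahlerFormC (S : SpecialKahlerOn M U) (x : M) (a b : RTangent x × RTangent x) : ℂ :=
  ((S.metric x (cxStr x a.1) b.1 - S.metric x (cxStr x a.2) b.2 : ℝ) : ℂ)
    + Complex.I * ((S.metric x (cxStr x a.1) b.2 + S.metric x (cxStr x a.2) b.1 : ℝ) : ℂ)

/-- `(∇_Y π^{(1,0)}) Z = ∇_Y (π^{(1,0)} Z) - π^{(1,0)} (∇_Y Z)`, with `∇` extended complex
linearly to sections of `T ⊗ ℂ`. -/
def covPiOneZero (S : SpecialKahlerOn M U) (Y Z : (x : M) → RTangent x) (x : M) :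
    RTangent x × RTangent x :=
  (S.conn (fun y => (piOneZero y (Z y)).1) x (Y x),
    S.conn (fun y => (piOneZero y (Z y)).2) x (Y x)) - piOneZero x (S.conn Z x (Y x))

/-- The holomorphic cubic form `Ξ = -ω(π^{(1,0)}, ∇ π^{(1,0)})` evaluated on real vector fields. -/
def cubicForm (S : SpecialKahlerOn M U) (X Y Z : (x : M) → RTangent x) (x : M) : ℂ :=
  -S.kahlerFormC x (piOneZero x (X x)) (S.covPiOneZero Y Z x)

/-- The coefficient `Ξ₀` in `Ξ = Ξ₀ dz³`, as a function of the coordinate `ζ = z(x)`; it is the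
value of `Ξ` on `(∂/∂x, ∂/∂x, ∂/∂x)`, because `dz(∂/∂x) = 1`. -/
def cubicCoeff (S : SpecialKahlerOn M U) (z : OpenPartialHomeomorph M ℂ) (ζ : ℂ) : ℂ :=
  S.cubicForm (coordField z 1) (coordField z 1) (coordField z 1) (z.symm ζ)

/-- In the coordinate `z`, centred at the puncture, `Ξ` has the finite order `n`. -/
def HasCubicOrder (S : SpecialKahlerOn M U) (z : OpenPartialHomeomorph M ℂ) (n : ℤ) : Prop :=
  MeromorphicAt (S.cubicCoeff z) 0 ∧ meromorphicOrderAt (S.cubicCoeff z) 0 = (n : WithTop ℤ)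

/-- The conformal factor `w` in `g = w |dz|²`, as a function of the coordinate. -/
def conformalFactor (S : SpecialKahlerOn M U) (z : OpenPartialHomeomorph M ℂ) (ζ : ℂ) : ℝ :=
  S.metric (z.symm ζ) (coordField z 1 (z.symm ζ)) (coordField z 1 (z.symm ζ))

/-- `w = r ^ β (C + o(1))` as `r = |z| → 0`, for some constant `C > 0`. -/
def IsConicalAt (S : SpecialKahlerOn M U) (z : OpenPartialHomeomorph M ℂ) (β : ℝ) : Prop :=
  ∃ C : ℝ, 0 < C ∧ Tendsto (fun ζ => S.conformalFactor z ζ / ‖ζ‖ ^ β) (𝓝[≠] 0) (𝓝 C)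

/-- `w = - r ^ k log r (C + o(1))` as `r = |z| → 0`, for some constant `C > 0`. -/
def IsLogarithmicAt (S : SpecialKahlerOn M U) (z : OpenPartialHomeomorph M ℂ) (k : ℤ) : Prop :=
  ∃ C : ℝ, 0 < C ∧ Tendsto
    (fun ζ => S.conformalFactor z ζ / (-(‖ζ‖ ^ k * Real.log ‖ζ‖))) (𝓝[≠] 0) (𝓝 C)

/-- The connection form `ω_∇` of `∇ = d + ω_∇` in the trivialization `(∂/∂x, ∂/∂y)` at the point
with coordinate `ζ`, evaluated on the tangent vector with coordinates `v`: column `j` consists of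
the components of `∇_v ∂_j`. -/
def connForm (S : SpecialKahlerOn M U) (z : OpenPartialHomeomorph M ℂ) (ζ v : ℂ) :
    Matrix (Fin 2) (Fin 2) ℝ :=
  Matrix.of fun i j =>
    Complex.basisOneI.repr
      (mfderiv 𝓘(ℝ, ℂ) 𝓘(ℝ, ℂ) z (z.symm ζ)
        (S.conn (coordField z (Complex.basisOneI j)) (z.symm ζ) (coordField z v (z.symm ζ)))) i

/-- The vector field along the counterclockwise circle `t ↦ p e^{it}` with components `V t` in
`(∂/∂x, ∂/∂y)` is parallel: `V' + ω_∇(γ') V = 0`, where `γ' = i p e^{it}`. -/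
def IsParallelAlongCircle (S : SpecialKahlerOn M U) (z : OpenPartialHomeomorph M ℂ) (p : ℂ)
    (V : ℝ → Fin 2 → ℝ) : Prop :=
  ∀ t : ℝ, HasDerivAt V
    (-(S.connForm z (p * Complex.exp (t * Complex.I))
        (Complex.I * p * Complex.exp (t * Complex.I)) *ᵥ V t)) t

/-- `A` is the matrix in `(∂/∂x, ∂/∂y)` of the holonomy of `∇` along the circle through `p` centred
at the origin of the coordinate, based at `p` and traversed once counterclockwise: every initial
vector extends to a parallel field, and parallel transport around the circle is `A`. -/
def IsCircleHolonomy (S : SpecialKahlerOn M U) (z : OpenPartialHomeomorph M ℂ) (p : ℂ)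
    (A : Matrix (Fin 2) (Fin 2) ℝ) : Prop :=
  (∀ v : Fin 2 → ℝ, ∃ V, S.IsParallelAlongCircle z p V ∧ V 0 = v) ∧
    ∀ V, S.IsParallelAlongCircle z p V → V (2 * Real.pi) = A *ᵥ V 0

end SpecialKahlerOn

end

/-! In the coordinate `z`, a torsion-free special connection has the form `∇_v u = ∂_v u + a v u + c
v̄ ū` with complex functions `a`, `c`. Each remaining hypothesis becomes a statement about `a` and
`c`. The equation `∇ω = 0` gives `d log w (v) = 2 Re (a v)`. The cubic form satisfies `|c| = 2 |Ξ₀|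
/ w`. Flatness reads `∂̄a = -|c|²` and `∂c = -a c`.

Pull back by `σ = s + i t ↦ p e^σ`, and put `G = a ζ`, `b = c ζ̄` with `ζ = p e^σ`. The circles
become the segments `s = const` of length `2π`, and the puncture is `s → -∞`. Let `α`, `β` (here not
the exponent) be the coefficients of the holonomy `v ↦ α v + β v̄` along such a segment. Three facts
determine it.

Conservation: flatness turns the dependence on `s` into a Lax equation `H' = [H, B]`
(`IsFlatStrip.hasDerivAt_holonomy`), so trace and determinant do not depend on the circle.

Limit: the order of `Ξ` and the asymptotics of `w` force `b → 0`, so `H` is asymptotic to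
multiplication by `exp (-i ∫ G dt)`. The real part of `∫ G dt` is the `s`-derivative of the circle
integral of `log w / 2`. It is monotone because `log w` is superharmonic, so `log w ~ (exponent) ·
s` can be differentiated, and `∫ G dt → π · exponent` (`IsFlatStrip.tendsto_integral_lin`). Hence
the holonomy has determinant `1` and trace `2 cos (π · exponent)`, and linear algebra over `ℝ`
yields the conjugacy classes.

Conical case with integral exponent: now `b` decays exponentially in `s`, and the distance of `H`
from the real scalars satisfies a differential inequality with coefficient `8 |b|`. It tends to zero
at `-∞`, so it vanishes identically (`IsFlatStrip.holonomy_eq_of_sin_eq_zero`) and `H = ±1`. -/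

/-! ### Global existence and uniqueness for linear differential equations -/

section LinearODE

variable {E : Type*} [NormedAddCommGroup E] [NormedSpace ℝ E]

/-- Integration gains a factor `1 / c` in the sup norm weighted by `exp (c |t|)`; this gain makes
the Picard operator a contraction on the whole line. -/
theorem norm_integral_le_of_norm_le_mul_exp_of_nonneg {f : ℝ → E} {c M t : ℝ} (hc : 0 < c)
    (hM : 0 ≤ M) (ht : 0 ≤ t) (hf : ∀ τ, ‖f τ‖ ≤ M * Real.exp (c * |τ|)) :
    ‖∫ τ in (0 : ℝ)..t, f τ‖ ≤ M / c * Real.exp (c * |t|) := by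
  have hd : ∀ x : ℝ, HasDerivAt (fun y => M / c * Real.exp (c * y)) (M * Real.exp (c * x)) x := by
    intro x
    have h1 : HasDerivAt (fun y : ℝ => c * y) (c * 1) x := (hasDerivAt_id x).const_mul c
    have := (h1.exp).const_mul (M / c)
    convert! this using 1
    field_simp
  have hi : ∫ τ in (0 : ℝ)..t, M * Real.exp (c * τ) =
      M / c * Real.exp (c * t) - M / c * Real.exp (c * 0) :=
    intervalIntegral.integral_eq_sub_of_hasDerivAt (fun x _ => hd x)
      (Continuous.intervalIntegrable (by fun_prop) _ _)
  have h2 : ‖∫ τ in (0 : ℝ)..t, f τ‖ ≤ ∫ τ in (0 : ℝ)..t, M * Real.exp (c * τ) := by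
    refine intervalIntegral.norm_integral_le_of_norm_le ht ?_
      (Continuous.intervalIntegrable (by fun_prop) _ _)
    refine Filter.Eventually.of_forall fun x hx => ?_
    have := hf x
    rwa [abs_of_pos hx.1] at this
  rw [abs_of_nonneg ht]
  have h3 : 0 ≤ M / c := by positivity
  rw [hi] at h2
  simp only [mul_zero, Real.exp_zero, mul_one] at h2
  linarith

theorem norm_integral_le_of_norm_le_mul_exp {f : ℝ → E} {c M : ℝ} (hc : 0 < c)
    (hM : 0 ≤ M) (t : ℝ) (hf : ∀ τ, ‖f τ‖ ≤ M * Real.exp (c * |τ|)) :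
    ‖∫ τ in (0 : ℝ)..t, f τ‖ ≤ M / c * Real.exp (c * |t|) := by
  rcases le_total 0 t with ht | ht
  · exact norm_integral_le_of_norm_le_mul_exp_of_nonneg hc hM ht hf
  · have h := norm_integral_le_of_norm_le_mul_exp_of_nonneg (f := fun τ => f (-τ)) hc hM
      (neg_nonneg.2 ht) (fun τ => by simpa using hf (-τ))
    rw [intervalIntegral.integral_comp_neg (fun τ => f τ)] at h
    rw [intervalIntegral.integral_symm, norm_neg]
    simpa using h

/-- A linear ordinary differential equation with bounded continuous coefficients has global
solutions. -/
theorem exists_hasDerivAt_linear [CompleteSpace E] {A : ℝ → E →L[ℝ] E} (hA : Continuous A) {K : ℝ}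
    (hK : 0 < K) (hAK : ∀ t, ‖A t‖ ≤ K) (v : E) :
    ∃ u : ℝ → E, u 0 = v ∧ ∀ t, HasDerivAt u (A t (u t)) t := by
  -- With the substitution `u = e • g` for bounded `g`, the rate `2 K` against the bound `K` on `A`
  -- gives the contraction constant `1 / 2`.
  let e : ℝ → ℝ := fun t => Real.exp (2 * K * |t|)
  have he : Continuous e := by fun_prop
  have he0 : ∀ t, 0 < e t := fun t => Real.exp_pos _
  have he1 : ∀ t, 1 ≤ e t := fun t => Real.one_le_exp (by positivity)
  let J : BoundedContinuousFunction ℝ E → ℝ → E :=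
    fun g t => ∫ τ in (0 : ℝ)..t, e τ • A τ (g τ)
  have hcont : ∀ g : BoundedContinuousFunction ℝ E, Continuous fun τ => e τ • A τ (g τ) :=
    fun g => he.smul (hA.clm_apply g.continuous)
  have hJ : ∀ g, Continuous (J g) := fun g =>
    intervalIntegral.continuous_primitive (fun a b => (hcont g).intervalIntegrable a b) 0
  have hJb : ∀ g t, ‖J g t‖ ≤ ‖g‖ / 2 * e t := by
    intro g t
    have := norm_integral_le_of_norm_le_mul_exp (f := fun τ => e τ • A τ (g τ)) (c := 2 * K)
      (M := K * ‖g‖) (by positivity) (by positivity) t (fun τ => by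
        rw [norm_smul, Real.norm_of_nonneg (he0 τ).le, mul_comm]
        refine mul_le_mul_of_nonneg_right ?_ (he0 τ).le
        exact (A τ).le_of_opNorm_le (hAK τ) _ |>.trans
          (mul_le_mul_of_nonneg_left (g.norm_coe_le_norm τ) hK.le))
    refine this.trans (le_of_eq ?_)
    simp only [e]
    field_simp
  have hJsub : ∀ g g' t, J g t - J g' t = J (g - g') t := by
    intro g g' t
    simp only [J]
    rw [← intervalIntegral.integral_sub ((hcont g).intervalIntegrable _ _)
      ((hcont g').intervalIntegrable _ _)]
    simp [smul_sub]
  let F : BoundedContinuousFunction ℝ E → BoundedContinuousFunction ℝ E := fun g =>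
    BoundedContinuousFunction.ofNormedAddCommGroup (fun t => (e t)⁻¹ • (v + J g t))
      ((he.inv₀ fun t => (he0 t).ne').smul (continuous_const.add (hJ g))) (‖v‖ + ‖g‖ / 2) (by
        intro t
        rw [norm_smul, norm_inv, Real.norm_of_nonneg (he0 t).le, inv_mul_le_iff₀ (he0 t)]
        refine (norm_add_le _ _).trans ?_
        have h1 := hJb g t
        have h2 : ‖v‖ ≤ e t * ‖v‖ := le_mul_of_one_le_left (norm_nonneg _) (he1 t)
        linarith)
  have hF : ContractingWith (1 / 2) F := by
    refine ⟨by rw [← NNReal.coe_lt_coe]; norm_num, LipschitzWith.of_dist_le_mul fun g g' => ?_⟩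
    rw [BoundedContinuousFunction.dist_le (by positivity)]
    intro t
    rw [dist_eq_norm, dist_eq_norm]
    have : F g t - F g' t = (e t)⁻¹ • J (g - g') t := by
      simp only [F, BoundedContinuousFunction.coe_ofNormedAddCommGroup]
      rw [← hJsub, ← smul_sub]
      congr 1
      abel
    rw [this, norm_smul, norm_inv, Real.norm_of_nonneg (he0 t).le, inv_mul_le_iff₀ (he0 t)]
    refine (hJb _ t).trans (le_of_eq ?_)
    push_cast
    ring
  let g := hF.fixedPoint
  have hg : F g = g := hF.fixedPoint_isFixedPt
  have hu : ∀ t, e t • g t = v + J g t := by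
    intro t
    have : g t = (e t)⁻¹ • (v + J g t) := by
      conv_lhs => rw [← hg]
      rfl
    rw [this, smul_inv_smul₀ (he0 t).ne']
  refine ⟨fun t => v + J g t, by simp [J], fun t => ?_⟩
  have h := (hcont g).integral_hasStrictDerivAt 0 t
  have h2 := (h.hasDerivAt.const_add v)
  change HasDerivAt _ (A t (v + J g t)) t
  rw [← hu t, map_smul]
  exact h2

/-- Solutions of a linear ordinary differential equation with bounded coefficients are determined
by their initial values. -/
theorem eq_of_hasDerivAt_linear {A : ℝ → E →L[ℝ] E} {K : ℝ}
    (hAK : ∀ t, ‖A t‖ ≤ K) {u v : ℝ → E} (hu : ∀ t, HasDerivAt u (A t (u t)) t)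
    (hv : ∀ t, HasDerivAt v (A t (v t)) t) (h0 : u 0 = v 0) : u = v := by
  refine ODE_solution_unique_univ (v := fun t x => A t x) (s := fun _ => univ) (K := K.toNNReal)
    (t₀ := 0) (fun t => ?_) (fun t => ⟨hu t, trivial⟩) (fun t => ⟨hv t, trivial⟩) h0
  refine ((A t).lipschitz.weaken ?_).lipschitzOnWith
  rw [← NNReal.coe_le_coe, Real.coe_toNNReal _ ((norm_nonneg _).trans (hAK t))]
  exact hAK t

end LinearODE

/-! ### Variation of parallel transport for a flat connection on a strip -/

section Frobenius

variable {𝔸 : Type*} [NormedRing 𝔸] [NormedAlgebra ℝ 𝔸]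

/-- If a function of `s` depending on a parameter `t` in a compact set is continuously
differentiable, it is differentiable uniformly in the parameter. -/
theorem eventually_forall_norm_sub_sub_le {E : Type*} [NormedAddCommGroup E] [NormedSpace ℝ E]
    {B B' : ℝ → ℝ → E} {S s : ℝ} (hs : s < S)
    (hB : ∀ s < S, ∀ t, HasDerivAt (fun s => B s t) (B' s t) s)
    (hB' : ContinuousOn (Function.uncurry B') (Iio S ×ˢ univ)) {k : Set ℝ} (hk : IsCompact k)
    {ε : ℝ} (hε : 0 < ε) :
    ∀ᶠ s' in 𝓝 s, ∀ t ∈ k, ‖B s' t - B s t - (s' - s) • B' s t‖ ≤ ε * |s' - s| := by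
  have h1 : ∀ᶠ s' in 𝓝 s, ∀ t ∈ k, ‖B' s' t - B' s t‖ < ε := by
    refine hk.eventually_forall_of_forall_eventually fun t _ => ?_
    have hc : ContinuousAt (fun q : ℝ × ℝ => ‖B' q.1 q.2 - B' s q.2‖) (s, t) := by
      have hopen : IsOpen (Iio S ×ˢ (univ : Set ℝ)) := isOpen_Iio.prod isOpen_univ
      have h2 : ContinuousAt (Function.uncurry B') (s, t) :=
        hB'.continuousAt (hopen.mem_nhds ⟨hs, trivial⟩)
      have h3 : ContinuousAt (fun q : ℝ × ℝ => Function.uncurry B' (s, q.2)) (s, t) :=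
        ContinuousAt.comp (f := fun q : ℝ × ℝ => (s, q.2)) (g := Function.uncurry B') h2
          (by fun_prop)
      exact (h2.sub h3).norm
    have : Tendsto (fun q : ℝ × ℝ => ‖B' q.1 q.2 - B' s q.2‖) (𝓝 (s, t)) (𝓝 0) := by
      simpa [ContinuousAt] using hc
    exact this.eventually (gt_mem_nhds hε)
  obtain ⟨δ, hδ, hball⟩ := Metric.eventually_nhds_iff_ball.1 (h1.and (gt_mem_nhds hs))
  filter_upwards [Metric.ball_mem_nhds s hδ] with s' hs' t ht
  have hder : ∀ x ∈ Metric.ball s δ, HasDerivWithinAt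
      (fun x => B x t - (x - s) • B' s t) (B' x t - B' s t) (Metric.ball s δ) x := by
    intro x hx
    have h := (hB x (hball x hx).2 t).sub
      (((hasDerivAt_id x).sub_const s).smul_const (B' s t))
    simp only [one_smul] at h
    exact h.hasDerivWithinAt
  have := Convex.norm_image_sub_le_of_norm_hasDerivWithin_le hder
    (fun x hx => ((hball x hx).1 t ht).le) (convex_ball s δ) (Metric.mem_ball_self hδ) hs'
  simp only [sub_self, zero_smul, sub_zero, Real.norm_eq_abs] at this
  rwa [sub_right_comm]

/-- Parallel transport along the curves `s = const` of a flat connection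
`d + B ds + A dt` on a strip, as a function of `s`. -/
theorem hasDerivAt_transport {A A' B B' Φ : ℝ → ℝ → 𝔸} {S : ℝ}
    (hA : ∀ s < S, ∀ t, HasDerivAt (fun s => A s t) (A' s t) s)
    (hB : ∀ s < S, ∀ t, HasDerivAt (fun t => B s t) (B' s t) t)
    (hAc : ContinuousOn (Function.uncurry A) (Iio S ×ˢ univ))
    (hAc' : ContinuousOn (Function.uncurry A') (Iio S ×ˢ univ))
    (hflat : ∀ s < S, ∀ t, A' s t - B' s t + B s t * A s t - A s t * B s t = 0)
    (hΦ : ∀ s < S, ∀ t, HasDerivAt (Φ s) (-(A s t * Φ s t)) t) (hΦ0 : ∀ s < S, Φ s 0 = 1)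
    {s : ℝ} (hs : s < S) {T : ℝ} (hT : 0 ≤ T) :
    HasDerivAt (fun s => Φ s T) (Φ s T * B s 0 - B s T * Φ s T) s := by
  -- `Y` is the expected derivative of `Φ` in `s`: by flatness it solves the linearised equation `Y'
  -- = -A Y - A' Φ`, and `Y 0 = 0` because `Φ s 0 = 1`.
  let Y : ℝ → 𝔸 := fun t => Φ s t * B s 0 - B s t * Φ s t
  have hopen : IsOpen (Iio S ×ˢ (univ : Set ℝ)) := isOpen_Iio.prod isOpen_univ
  have hΦc : Continuous (Φ s) :=
    continuous_iff_continuousAt.2 fun t => (hΦ s hs t).continuousAt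
  have hBc : Continuous (B s) :=
    continuous_iff_continuousAt.2 fun t => (hB s hs t).continuousAt
  have hYc : Continuous Y := (hΦc.mul continuous_const).sub (hBc.mul hΦc)
  obtain ⟨M, hM⟩ := (isCompact_Icc (a := (0 : ℝ)) (b := T)).exists_bound_of_continuousOn
    (f := fun t => (Φ s t, Y t)) (hΦc.prodMk hYc).continuousOn
  have hMΦ : ∀ t ∈ Icc 0 T, ‖Φ s t‖ ≤ M := fun t ht => (norm_fst_le _).trans (hM t ht)
  have hMY : ∀ t ∈ Icc 0 T, ‖Y t‖ ≤ M := fun t ht => (norm_snd_le _).trans (hM t ht)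
  have hM0 : 0 ≤ M := (norm_nonneg _).trans (hMΦ 0 ⟨le_rfl, hT⟩)
  obtain ⟨K₀, hK₀⟩ := (isCompact_Icc (a := (0 : ℝ)) (b := T)).exists_bound_of_continuousOn
    (f := fun t => A s t) (by
      refine Continuous.continuousOn (continuous_iff_continuousAt.2 fun t => ?_)
      exact ContinuousAt.comp (f := fun t : ℝ => (s, t)) (g := Function.uncurry A)
        (hAc.continuousAt (hopen.mem_nhds ⟨hs, trivial⟩)) (by fun_prop))
  have hK₀0 : 0 ≤ K₀ := (norm_nonneg _).trans (hK₀ 0 ⟨le_rfl, hT⟩)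
  have hAev : ∀ ε > 0, ∀ᶠ s' in 𝓝 s, ∀ t ∈ Icc 0 T, ‖A s' t - A s t‖ < ε := by
    intro ε hε
    refine isCompact_Icc.eventually_forall_of_forall_eventually fun t _ => ?_
    have h2 : ContinuousAt (Function.uncurry A) (s, t) :=
      hAc.continuousAt (hopen.mem_nhds ⟨hs, trivial⟩)
    have h3 : ContinuousAt (fun q : ℝ × ℝ => Function.uncurry A (s, q.2)) (s, t) :=
      ContinuousAt.comp (f := fun q : ℝ × ℝ => (s, q.2)) (g := Function.uncurry A) h2
        (by fun_prop)
    have : Tendsto (fun q : ℝ × ℝ => ‖A q.1 q.2 - A s q.2‖) (𝓝 (s, t)) (𝓝 0) := by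
      simpa [ContinuousAt] using! (h2.sub h3).norm
    exact this.eventually (gt_mem_nhds hε)
  have hflat' : ∀ t, B' s t = A' s t + B s t * A s t - A s t * B s t := by
    intro t
    have := hflat s hs t
    rw [← sub_eq_zero, ← neg_eq_zero, ← this]
    abel
  set K := K₀ + 1 with hKdef
  have hK : 0 < K := by positivity
  -- The Grönwall factor for rate `K` on `[0, T]`; the `2 * M` collects the two error terms, each
  -- bounded by `M * ε * |s' - s|`.
  set c := (Real.exp (K * T) - 1) / K * (2 * M) with hcdef
  have hc : 0 ≤ c := by
    have : 1 ≤ Real.exp (K * T) := Real.one_le_exp (by positivity)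
    have : 0 ≤ Real.exp (K * T) - 1 := by linarith
    positivity
  rw [hasDerivAt_iff_isLittleO, Asymptotics.isLittleO_iff]
  intro η hη
  obtain ⟨ε, hε, hεη⟩ : ∃ ε > 0, c * ε ≤ η := by
    refine ⟨η / (c + 1), by positivity, ?_⟩
    rw [mul_div_assoc', div_le_iff₀ (by positivity)]
    nlinarith
  filter_upwards [hAev 1 one_pos, hAev ε hε, gt_mem_nhds hs,
    eventually_forall_norm_sub_sub_le hs hA hAc' (isCompact_Icc (a := (0 : ℝ)) (b := T)) hε]
    with s' h1 h2 hs' h4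
  -- The first order remainder vanishes at `t = 0` and solves a linear equation whose inhomogeneity
  -- is small compared with `s' - s`, uniformly in `t`.
  let D : ℝ → 𝔸 := fun t => Φ s' t - Φ s t - (s' - s) • Y t
  let D' : ℝ → 𝔸 := fun t => -(A s' t * D t) - (A s' t - A s t - (s' - s) • A' s t) * Φ s t
      - (s' - s) • ((A s' t - A s t) * Y t)
  have hD : ∀ t, HasDerivAt D (D' t) t := by
    intro t
    have hY : HasDerivAt Y (-(A s t * Φ s t) * B s 0
        - (B' s t * Φ s t + B s t * -(A s t * Φ s t))) t :=
      ((hΦ s hs t).mul_const _).sub ((hB s hs t).mul (hΦ s hs t))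
    convert! ((hΦ s' hs' t).sub (hΦ s hs t)).sub (hY.const_smul (s' - s)) using 1
    simp only [D', D, Y, hflat' t]
    simp only [mul_sub, sub_mul, smul_sub, smul_add, add_mul, mul_neg, neg_mul, smul_mul_assoc,
      mul_smul_comm, mul_assoc, smul_neg]
    abel
  have hD0 : D 0 = 0 := by simp [D, Y, hΦ0 s hs, hΦ0 s' hs']
  have hbd := norm_le_gronwallBound_of_norm_deriv_right_le (f := D) (f' := D') (δ := 0) (K := K)
    (ε := 2 * M * (ε * |s' - s|)) (a := 0) (b := T)
    (fun t _ => (hD t).continuousAt.continuousWithinAt)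
    (fun t _ => (hD t).hasDerivWithinAt) (by simp [hD0]) (by
      intro t ht
      have ht' : t ∈ Icc 0 T := ⟨ht.1, ht.2.le⟩
      have e1 : ‖A s' t‖ ≤ K := by
        have := norm_le_norm_add_norm_sub' (A s' t) (A s t)
        linarith [h1 t ht', hK₀ t ht']
      have e2 : ‖A s' t * D t‖ ≤ K * ‖D t‖ :=
        (norm_mul_le _ _).trans (mul_le_mul_of_nonneg_right e1 (norm_nonneg _))
      have e3 : ‖(A s' t - A s t - (s' - s) • A' s t) * Φ s t‖ ≤ ε * |s' - s| * M :=
        (norm_mul_le _ _).trans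
          (mul_le_mul (h4 t ht') (hMΦ t ht') (norm_nonneg _) (by positivity))
      have e4 : ‖(s' - s) • ((A s' t - A s t) * Y t)‖ ≤ |s' - s| * (ε * M) := by
        rw [norm_smul, Real.norm_eq_abs]
        refine mul_le_mul_of_nonneg_left ((norm_mul_le _ _).trans ?_) (abs_nonneg _)
        exact mul_le_mul (h2 t ht').le (hMY t ht') (norm_nonneg _) hε.le
      have e5 : ‖D' t‖ ≤ ‖A s' t * D t‖ + ‖(A s' t - A s t - (s' - s) • A' s t) * Φ s t‖
          + ‖(s' - s) • ((A s' t - A s t) * Y t)‖ := by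
        refine (norm_sub_le _ _).trans (add_le_add_left ((norm_sub_le _ _).trans ?_) _)
        rw [norm_neg]
      linarith) T ⟨hT, le_rfl⟩
  rw [gronwallBound_of_K_ne_0 hK.ne'] at hbd
  simp only [sub_zero, zero_mul, zero_add] at hbd
  refine hbd.trans ?_
  rw [Real.norm_eq_abs]
  calc 2 * M * (ε * |s' - s|) / K * (Real.exp (K * T) - 1) = (c * ε) * |s' - s| := by
        rw [hcdef]; ring
    _ ≤ η * |s' - s| := mul_le_mul_of_nonneg_right hεη (abs_nonneg _)

/-- A linear equation `Φ' = -A Φ` in a Banach algebra has a fundamental solution. -/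
theorem exists_fundamental_solution [CompleteSpace 𝔸] {A : ℝ → 𝔸} (hA : Continuous A) {K : ℝ}
    (hK : 0 < K) (hAK : ∀ t, ‖A t‖ ≤ K) :
    ∃ Φ : ℝ → 𝔸, Φ 0 = 1 ∧ ∀ t, HasDerivAt Φ (-(A t * Φ t)) t := by
  obtain ⟨Φ, h0, hΦ⟩ := exists_hasDerivAt_linear
    (A := fun t => ContinuousLinearMap.mul ℝ 𝔸 (-A t))
    ((ContinuousLinearMap.continuous _).comp hA.neg) hK (fun t => by
      refine (ContinuousLinearMap.opNorm_mul_apply_le ℝ 𝔸 _).trans ?_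
      rw [norm_neg]
      exact hAK t) 1
  refine ⟨Φ, h0, fun t => ?_⟩
  have := hΦ t
  rwa [ContinuousLinearMap.mul_apply', neg_mul] at this

end Frobenius

/-! ### Real two by two matrices determined by trace and determinant -/

section Classification

theorem Matrix.isConj_of_mul_eq {A B P : Matrix (Fin 2) (Fin 2) ℝ} (hP : P.det ≠ 0)
    (h : P * A = B * P) : IsConj A B :=
  ⟨Matrix.nonsingInvUnit P (isUnit_iff_ne_zero.2 hP), h⟩

/-- The discriminant `tr² - 4 det = -4 sin² θ` is negative, so `A` is not triangular and `A 0 1 ≠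
0`. Once the first row of the intertwiner is `(sin θ, 0)`, the first row of `P A = R P` forces the
second. -/
theorem isConj_rotation_of_trace_of_det {A : Matrix (Fin 2) (Fin 2) ℝ} {θ : ℝ}
    (htr : A.trace = 2 * Real.cos θ) (hdet : A.det = 1) (hθ : Real.sin θ ≠ 0) :
    IsConj A !![Real.cos θ, -Real.sin θ; Real.sin θ, Real.cos θ] := by
  rw [Matrix.trace_fin_two] at htr
  rw [Matrix.det_fin_two] at hdet
  have hsc := Real.sin_sq_add_cos_sq θ
  have hs2 : 0 < Real.sin θ ^ 2 := by positivity
  have hb : A 0 1 ≠ 0 := by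
    intro hb
    rw [hb] at hdet
    have h2 : (A 0 0 + A 1 1) ^ 2 = (2 * Real.cos θ) ^ 2 := by rw [htr]
    nlinarith [sq_nonneg (A 0 0 - A 1 1)]
  refine Matrix.isConj_of_mul_eq
    (P := !![Real.sin θ, 0; Real.cos θ - A 0 0, -A 0 1]) ?_ ?_
  · rw [Matrix.det_fin_two_of]
    simp [hθ, hb]
  · have hd : A 1 1 = 2 * Real.cos θ - A 0 0 := by linarith
    rw [hd] at hdet
    rw [Matrix.eta_fin_two A, hd]
    ext i j
    fin_cases i <;> fin_cases j <;> simp [Matrix.mul_apply, Fin.sum_univ_two] <;> nlinarith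

/-- By Cayley–Hamilton, `N = A - ε` has square zero. If `N ≠ 0`, the intertwiner has rows `u` and `u
N` for a coordinate row vector `u` with `u N ≠ 0`; the cases decide which coordinate vector works.
-/
theorem eq_or_isConj_of_trace_of_det {A : Matrix (Fin 2) (Fin 2) ℝ} {ε : ℝ} (hε : ε ^ 2 = 1)
    (htr : A.trace = 2 * ε) (hdet : A.det = 1) :
    A = !![ε, 0; 0, ε] ∨ IsConj A !![ε, 1; 0, ε] := by
  rw [Matrix.trace_fin_two] at htr
  rw [Matrix.det_fin_two] at hdet
  have hd : A 1 1 = 2 * ε - A 0 0 := by linarith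
  by_cases hb : A 0 1 = 0
  · have ha : A 0 0 = ε := by
      rw [hb, hd] at hdet
      have : (A 0 0 - ε) ^ 2 = 0 := by linear_combination hε - hdet
      linarith [pow_eq_zero_iff (two_ne_zero) |>.1 this]
    by_cases hc : A 1 0 = 0
    · left
      rw [Matrix.eta_fin_two A, hb, hc, hd, ha]
      congr! 3
      ring_nf
    · right
      refine Matrix.isConj_of_mul_eq (P := !![0, 1; A 1 0, A 1 1 - ε]) ?_ ?_
      · rw [Matrix.det_fin_two_of]
        simpa using hc
      · rw [Matrix.eta_fin_two A, hb, hd, ha]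
        ext i j
        fin_cases i <;> fin_cases j <;> simp [Matrix.mul_apply, Fin.sum_univ_two] <;> ring
  · right
    refine Matrix.isConj_of_mul_eq (P := !![1, 0; A 0 0 - ε, A 0 1]) ?_ ?_
    · rw [Matrix.det_fin_two_of]
      simpa using hb
    · rw [hd] at hdet
      rw [Matrix.eta_fin_two A, hd]
      ext i j
      fin_cases i <;> fin_cases j <;> simp [Matrix.mul_apply, Fin.sum_univ_two] <;> nlinarith

end Classification

/-! ### Real linear maps of the complex line as `v ↦ α v + β v̄` -/

noncomputable section RealLinear

open ComplexConjugate

/-- The real linear endomorphism `v ↦ α v + β v̄` of `ℂ`. -/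
def conjLin (α β : ℂ) : ℂ →L[ℝ] ℂ :=
  α • (1 : ℂ →L[ℝ] ℂ) + β • (Complex.conjCLE : ℂ →L[ℝ] ℂ)

@[simp]
theorem conjLin_apply (α β v : ℂ) : conjLin α β v = α * v + β * conj v := by
  simp [conjLin]

theorem conjLin_mul (α β γ δ : ℂ) :
    conjLin α β * conjLin γ δ = conjLin (α * γ + β * conj δ) (α * δ + β * conj γ) := by
  refine ContinuousLinearMap.ext fun v => ?_
  simp only [ContinuousLinearMap.mul_def, ContinuousLinearMap.comp_apply, conjLin_apply, map_add,
    map_mul, Complex.conj_conj]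
  ring

theorem conjLin_add (α β γ δ : ℂ) :
    conjLin α β + conjLin γ δ = conjLin (α + γ) (β + δ) := by
  refine ContinuousLinearMap.ext fun v => ?_
  simp
  ring

theorem conjLin_sub (α β γ δ : ℂ) :
    conjLin α β - conjLin γ δ = conjLin (α - γ) (β - δ) := by
  refine ContinuousLinearMap.ext fun v => ?_
  simp
  ring

theorem conjLin_zero : conjLin 0 0 = 0 := by
  refine ContinuousLinearMap.ext fun v => ?_
  simp

theorem HasDerivAt.conjLin {α β : ℝ → ℂ} {α' β' : ℂ} {t : ℝ} (hα : HasDerivAt α α' t)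
    (hβ : HasDerivAt β β' t) :
    HasDerivAt (fun t => _root_.conjLin (α t) (β t)) (_root_.conjLin α' β') t :=
  (hα.smul_const (1 : ℂ →L[ℝ] ℂ)).add (hβ.smul_const (Complex.conjCLE : ℂ →L[ℝ] ℂ))

theorem ContinuousOn.conjLin {X : Type*} [TopologicalSpace X] {α β : X → ℂ} {s : Set X}
    (hα : ContinuousOn α s) (hβ : ContinuousOn β s) :
    ContinuousOn (fun t => _root_.conjLin (α t) (β t)) s :=
  (hα.smul continuousOn_const).add (hβ.smul continuousOn_const)

/-- The complex linear coefficient `α` of a real linear map `v ↦ α v + β v̄`. -/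
def linCoeff (T : ℂ →L[ℝ] ℂ) : ℂ := (T 1 - Complex.I * T Complex.I) / 2

/-- The antilinear coefficient `β` of a real linear map `v ↦ α v + β v̄`. -/
def conjCoeff (T : ℂ →L[ℝ] ℂ) : ℂ := (T 1 + Complex.I * T Complex.I) / 2

@[simp]
theorem linCoeff_conjLin (α β : ℂ) : linCoeff (conjLin α β) = α := by
  simp only [linCoeff, conjLin_apply, map_one, Complex.conj_I]
  linear_combination (-α / 2 + β / 2) * Complex.I_mul_I

@[simp]
theorem conjCoeff_conjLin (α β : ℂ) : conjCoeff (conjLin α β) = β := by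
  simp only [conjCoeff, conjLin_apply, map_one, Complex.conj_I]
  linear_combination (α / 2 - β / 2) * Complex.I_mul_I

theorem conjLin_coeff (T : ℂ →L[ℝ] ℂ) : conjLin (linCoeff T) (conjCoeff T) = T := by
  refine ContinuousLinearMap.ext fun v => ?_
  have hv : v = v.re • (1 : ℂ) + v.im • Complex.I := by
    rw [Complex.real_smul, Complex.real_smul, mul_one, Complex.re_add_im]
  have hT : T v = v.re * T 1 + v.im * T Complex.I := by
    conv_lhs => rw [hv]
    simp [-Complex.real_smul, map_add, map_smul]
    simp
  have hc : conj v = v.re - v.im * Complex.I := by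
    apply Complex.ext <;> simp
  rw [hT, conjLin_apply, linCoeff, conjCoeff, hc]
  nth_rw 1 [hv]
  simp only [Complex.real_smul, mul_one]
  linear_combination (-(v.im : ℂ) * T Complex.I) * Complex.I_mul_I

theorem HasDerivAt.linCoeff {T : ℝ → ℂ →L[ℝ] ℂ} {T' : ℂ →L[ℝ] ℂ} {t : ℝ}
    (hT : HasDerivAt T T' t) :
    HasDerivAt (fun t => _root_.linCoeff (T t)) (_root_.linCoeff T') t := by
  have h : ∀ v : ℂ, HasDerivAt (fun t => T t v) (T' v) t := fun v => by
    simpa using hT.clm_apply (hasDerivAt_const t v)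
  exact ((h 1).sub ((h Complex.I).const_mul Complex.I)).div_const 2

theorem HasDerivAt.conjCoeff {T : ℝ → ℂ →L[ℝ] ℂ} {T' : ℂ →L[ℝ] ℂ} {t : ℝ}
    (hT : HasDerivAt T T' t) :
    HasDerivAt (fun t => _root_.conjCoeff (T t)) (_root_.conjCoeff T') t := by
  have h : ∀ v : ℂ, HasDerivAt (fun t => T t v) (T' v) t := fun v => by
    simpa using hT.clm_apply (hasDerivAt_const t v)
  exact ((h 1).add ((h Complex.I).const_mul Complex.I)).div_const 2

end RealLinear

/-! ### Differentiation under the integral and derivatives at minus infinity -/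

section ParametricIntegral

theorem hasDerivAt_integral_of_continuousOn {f f' : ℝ → ℝ → ℝ} {S s T : ℝ} (hs : s < S)
    (hT : 0 < T) (hf : ∀ s < S, ∀ t, HasDerivAt (fun s => f s t) (f' s t) s)
    (hfc : ∀ s < S, Continuous (f s))
    (hf' : ContinuousOn (Function.uncurry f') (Iio S ×ˢ univ)) :
    HasDerivAt (fun s => ∫ t in (0 : ℝ)..T, f s t) (∫ t in (0 : ℝ)..T, f' s t) s := by
  have hf'c : Continuous (f' s) := by
    refine continuous_iff_continuousAt.2 fun t => ?_
    exact ContinuousAt.comp (f := fun t : ℝ => (s, t)) (g := Function.uncurry f')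
      (hf'.continuousAt ((isOpen_Iio.prod isOpen_univ).mem_nhds ⟨hs, trivial⟩)) (by fun_prop)
  rw [hasDerivAt_iff_isLittleO, Asymptotics.isLittleO_iff]
  intro η hη
  filter_upwards [gt_mem_nhds hs, eventually_forall_norm_sub_sub_le hs hf hf'
    (isCompact_Icc (a := (0 : ℝ)) (b := T)) (div_pos hη hT)] with s' hs' h
  rw [← intervalIntegral.integral_sub ((hfc s' hs').intervalIntegrable _ _)
    ((hfc s hs).intervalIntegrable _ _), ← intervalIntegral.integral_smul,
    ← intervalIntegral.integral_sub (f := fun x => f s' x - f s x)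
      (g := fun x => (s' - s) • f' s x) (((hfc s' hs').sub (hfc s hs)).intervalIntegrable _ _)
    (Continuous.intervalIntegrable (hf'c.const_smul (s' - s)) _ _)]
  have := intervalIntegral.norm_integral_le_of_norm_le_const (a := 0) (b := T)
    (f := fun t => f s' t - f s t - (s' - s) • f' s t) (C := η / T * |s' - s|) (fun t ht => by
      rw [uIoc_of_le hT.le] at ht
      exact h t ⟨ht.1.le, ht.2⟩)
  refine this.trans (le_of_eq ?_)
  rw [sub_zero, abs_of_pos hT, Real.norm_eq_abs]
  field_simp

/-- If `L` is differentiable with antitone derivative `φ` near `-∞` and `L s ~ c s`, then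
`φ s → c`. -/
theorem tendsto_deriv_atBot_of_antitoneOn {L φ : ℝ → ℝ} {S c : ℝ}
    (hL : ∀ s < S, HasDerivAt L (φ s) s) (hφ : AntitoneOn φ (Iio S))
    (hLc : Tendsto (fun s => L s / s) atBot (𝓝 c)) : Tendsto φ atBot (𝓝 c) := by
  -- An antitone derivative makes `L` concave, so each secant slope lies between the derivatives at
  -- its ends. With one end fixed and the other going to `-∞`, the slope tends to `c`, which bounds
  -- `φ` from both sides.
  have hmv : ∀ s s₀, s < s₀ → s₀ < S →
      φ s₀ * (s₀ - s) ≤ L s₀ - L s ∧ L s₀ - L s ≤ φ s * (s₀ - s) := by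
    intro s s₀ h h0
    obtain ⟨x, hx, hxe⟩ := exists_hasDerivAt_eq_slope L φ h
      (fun y hy => (hL y (hy.2.trans_lt h0)).continuousAt.continuousWithinAt)
      (fun y hy => hL y (hy.2.trans h0))
    have hpos : 0 < s₀ - s := sub_pos.2 h
    rw [eq_div_iff hpos.ne'] at hxe
    rw [← hxe]
    have hxS : x < S := hx.2.trans h0
    exact ⟨mul_le_mul_of_nonneg_right (hφ hxS h0 hx.2.le) hpos.le,
      mul_le_mul_of_nonneg_right (hφ (h.trans h0) hxS hx.1.le) hpos.le⟩
  have hq : ∀ s₀, Tendsto (fun s => (L s₀ - L s) / (s₀ - s)) atBot (𝓝 c) := by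
    intro s₀
    have h1 : Tendsto (fun s : ℝ => L s₀ / s) atBot (𝓝 0) := tendsto_const_nhds.div_atBot tendsto_id
    have h2 : Tendsto (fun s : ℝ => s₀ / s) atBot (𝓝 0) := tendsto_const_nhds.div_atBot tendsto_id
    have h3 := (h1.sub hLc).div (h2.sub_const 1) (by norm_num)
    rw [show (0 - c) / (0 - 1) = c by ring] at h3
    refine h3.congr' ?_
    filter_upwards [eventually_lt_atBot 0, eventually_lt_atBot s₀] with s hs hs'
    have : s₀ - s ≠ 0 := (sub_pos.2 hs').ne'
    have hs0 : s ≠ 0 := hs.ne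
    simp only [Pi.div_apply]
    rw [← sub_div, div_sub_one hs0, div_div_div_cancel_right₀ hs0]
  have hle : ∀ s₀ < S, φ s₀ ≤ c := by
    intro s₀ h0
    refine ge_of_tendsto (hq s₀) ?_
    filter_upwards [eventually_lt_atBot s₀] with s hs
    rw [le_div_iff₀ (sub_pos.2 hs)]
    exact (hmv s s₀ hs h0).1
  have hS : S - 1 < S := by linarith
  refine tendsto_of_tendsto_of_tendsto_of_le_of_le' (hq (S - 1)) tendsto_const_nhds ?_ ?_
  · filter_upwards [eventually_lt_atBot (S - 1)] with s hs
    rw [div_le_iff₀ (sub_pos.2 hs)]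
    exact (hmv s _ hs hS).2
  · filter_upwards [eventually_lt_atBot S] with s hs
    exact hle s hs

end ParametricIntegral

/-! ### Flat connections on a half-plane with period `2πi` -/

noncomputable section

open ComplexConjugate

/-- In a logarithmic coordinate `σ = s + i t` on a left half-plane, the data of a flat torsion-free
special connection `∇_v u = ∂_v u + G v u + b v̄ ū` with period `2πi`. -/
structure IsFlatStrip (S : ℝ) (G b : ℂ → ℂ) : Prop where
  contDiffOn_lin : ContDiffOn ℝ 1 G {σ | σ.re < S}
  contDiffOn_conj : ContDiffOn ℝ 1 b {σ | σ.re < S}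
  flat_lin : ∀ σ : ℂ, σ.re < S →
    fderiv ℝ G σ 1 + Complex.I * fderiv ℝ G σ Complex.I = -2 * (b σ * conj (b σ))
  flat_conj : ∀ σ : ℂ, σ.re < S →
    fderiv ℝ b σ 1 - Complex.I * fderiv ℝ b σ Complex.I = -2 * (G σ * b σ)
  periodic_lin : ∀ σ, G (σ + 2 * Real.pi * Complex.I) = G σ
  periodic_conj : ∀ σ, b (σ + 2 * Real.pi * Complex.I) = b σ

/-- The logarithmic coordinate `s + i t`. -/
def logCoord (s t : ℝ) : ℂ := s + t * Complex.I

@[simp]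
theorem logCoord_re (s t : ℝ) : (logCoord s t).re = s := by simp [logCoord]

theorem logCoord_add_two_pi (s t : ℝ) :
    logCoord s (t + 2 * Real.pi) = logCoord s t + 2 * Real.pi * Complex.I := by
  simp only [logCoord]
  push_cast
  ring

theorem logCoord_two_pi (s : ℝ) :
    logCoord s (2 * Real.pi) = logCoord s 0 + 2 * Real.pi * Complex.I := by
  rw [← logCoord_add_two_pi, zero_add]

theorem continuous_logCoord : Continuous (Function.uncurry logCoord) := by
  unfold logCoord Function.uncurry
  fun_prop

theorem hasDerivAt_logCoord_left (s t : ℝ) : HasDerivAt (fun s => logCoord s t) 1 s := by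
  simpa [logCoord] using (Complex.ofRealCLM.hasDerivAt (x := s)).add_const (t * Complex.I)

theorem hasDerivAt_logCoord_right (s t : ℝ) : HasDerivAt (logCoord s) Complex.I t := by
  have := ((Complex.ofRealCLM.hasDerivAt (x := t)).mul_const Complex.I).const_add (s : ℂ)
  unfold logCoord
  convert! this using 1
  simp

section Strip

variable {S : ℝ} {f : ℂ → ℂ}

theorem isOpen_re_lt (S : ℝ) : IsOpen {σ : ℂ | σ.re < S} :=
  isOpen_lt Complex.continuous_re continuous_const

theorem ContDiffOn.hasFDerivAt_of_re_lt (hf : ContDiffOn ℝ 1 f {σ | σ.re < S}) {σ : ℂ}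
    (hσ : σ.re < S) : HasFDerivAt f (fderiv ℝ f σ) σ :=
  ((hf.differentiableOn one_ne_zero).differentiableAt
    ((isOpen_re_lt S).mem_nhds hσ)).hasFDerivAt

theorem ContDiffOn.hasDerivAt_logCoord_left (hf : ContDiffOn ℝ 1 f {σ | σ.re < S}) {s : ℝ}
    (hs : s < S) (t : ℝ) :
    HasDerivAt (fun s => f (logCoord s t)) (fderiv ℝ f (logCoord s t) 1) s :=
  (hf.hasFDerivAt_of_re_lt (by simpa using hs)).comp_hasDerivAt s
    (_root_.hasDerivAt_logCoord_left s t)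

theorem ContDiffOn.hasDerivAt_logCoord_right (hf : ContDiffOn ℝ 1 f {σ | σ.re < S}) {s : ℝ}
    (hs : s < S) (t : ℝ) :
    HasDerivAt (fun t => f (logCoord s t)) (fderiv ℝ f (logCoord s t) Complex.I) t :=
  (hf.hasFDerivAt_of_re_lt (by simpa using hs)).comp_hasDerivAt t
    (_root_.hasDerivAt_logCoord_right s t)

theorem ContinuousOn.comp_logCoord {X : Type*} [TopologicalSpace X] {f : ℂ → X}
    (hf : ContinuousOn f {σ | σ.re < S}) :
    ContinuousOn (Function.uncurry fun s t => f (logCoord s t)) (Iio S ×ˢ univ) :=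
  hf.comp (f := Function.uncurry logCoord) continuous_logCoord.continuousOn
    (fun q hq => by simpa [Function.uncurry] using hq.1)

theorem ContinuousOn.continuous_logCoord {X : Type*} [TopologicalSpace X] {f : ℂ → X}
    (hf : ContinuousOn f {σ | σ.re < S}) {s : ℝ} (hs : s < S) :
    Continuous fun t => f (logCoord s t) :=
  hf.comp_continuous (_root_.continuous_logCoord.comp (by fun_prop : Continuous fun t => (s, t)))
    (fun t => by simpa using hs)

theorem ContDiffOn.continuousOn_fderiv_apply (hf : ContDiffOn ℝ 1 f {σ | σ.re < S}) (v : ℂ) :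
    ContinuousOn (fun σ => fderiv ℝ f σ v) {σ | σ.re < S} :=
  (hf.continuousOn_fderiv_of_isOpen (isOpen_re_lt S) le_rfl).clm_apply continuousOn_const

end Strip

theorem Function.Periodic.exists_norm_le {E : Type*} [SeminormedAddCommGroup E] {f : ℝ → E} {c : ℝ}
    (hf : Function.Periodic f c) (hc : 0 < c) (hfc : Continuous f) :
    ∃ K, 0 < K ∧ ∀ t, ‖f t‖ ≤ K := by
  obtain ⟨K, hK⟩ := (isCompact_Icc (a := (0 : ℝ)) (b := 0 + c)).exists_bound_of_continuousOn
    hfc.continuousOn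
  refine ⟨max K 1, by positivity, fun t => ?_⟩
  obtain ⟨y, hy, hty⟩ := hf.exists_mem_Ico hc t 0
  rw [hty]
  exact (hK y ⟨hy.1, hy.2.le⟩).trans (le_max_left _ _)

namespace IsFlatStrip

variable {S : ℝ} {G b : ℂ → ℂ}

/-- The coefficient of `ds` in the connection form. -/
def radial (G b : ℂ → ℂ) (s t : ℝ) : ℂ →L[ℝ] ℂ :=
  conjLin (G (logCoord s t)) (b (logCoord s t))

/-- The coefficient of `dt` in the connection form. -/
def angular (G b : ℂ → ℂ) (s t : ℝ) : ℂ →L[ℝ] ℂ :=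
  conjLin (Complex.I * G (logCoord s t)) (-(Complex.I * b (logCoord s t)))

theorem continuous_angular (h : IsFlatStrip S G b) {s : ℝ} (hs : s < S) :
    Continuous (angular G b s) := by
  rw [← continuousOn_univ]
  have h1 := (h.contDiffOn_lin.continuousOn.continuous_logCoord hs).continuousOn (s := univ)
  have h2 := (h.contDiffOn_conj.continuousOn.continuous_logCoord hs).continuousOn (s := univ)
  exact (continuousOn_const.mul h1).conjLin (continuousOn_const.mul h2).neg

theorem periodic_angular (h : IsFlatStrip S G b) (s : ℝ) :
    Function.Periodic (angular G b s) (2 * Real.pi) := by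
  intro t
  simp only [angular, logCoord_add_two_pi, h.periodic_lin, h.periodic_conj]

theorem exists_transport (h : IsFlatStrip S G b) {s : ℝ} (hs : s < S) :
    ∃ Φ : ℝ → ℂ →L[ℝ] ℂ, Φ 0 = 1 ∧ ∀ t, HasDerivAt Φ (-(angular G b s t * Φ t)) t := by
  obtain ⟨K, hK, hKb⟩ := (h.periodic_angular s).exists_norm_le Real.two_pi_pos
    (h.continuous_angular hs)
  exact exists_fundamental_solution (h.continuous_angular hs) hK hKb

/-- The two flatness equations are the linear and antilinear parts of zero curvature. Periodicity
identifies the radial form at `t = 0` and `t = 2π`, so the transport law closes up into a Lax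
equation and the holonomy moves within a conjugacy class. -/
theorem hasDerivAt_holonomy (h : IsFlatStrip S G b) {Φ : ℝ → ℝ → ℂ →L[ℝ] ℂ}
    (hΦ0 : ∀ s < S, Φ s 0 = 1)
    (hΦ : ∀ s < S, ∀ t, HasDerivAt (Φ s) (-(angular G b s t * Φ s t)) t) {s : ℝ} (hs : s < S) :
    HasDerivAt (fun s => Φ s (2 * Real.pi))
      (Φ s (2 * Real.pi) * radial G b s 0 - radial G b s 0 * Φ s (2 * Real.pi)) s := by
  have key := hasDerivAt_transport (A := angular G b) (B := radial G b) (Φ := Φ) (S := S)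
    (A' := fun s t => conjLin (Complex.I * fderiv ℝ G (logCoord s t) 1)
      (-(Complex.I * fderiv ℝ b (logCoord s t) 1)))
    (B' := fun s t => conjLin (fderiv ℝ G (logCoord s t) Complex.I)
      (fderiv ℝ b (logCoord s t) Complex.I))
    (fun s hs t => ((h.contDiffOn_lin.hasDerivAt_logCoord_left hs t).const_mul _).conjLin
      ((h.contDiffOn_conj.hasDerivAt_logCoord_left hs t).const_mul _).neg)
    (fun s hs t => (h.contDiffOn_lin.hasDerivAt_logCoord_right hs t).conjLin
      (h.contDiffOn_conj.hasDerivAt_logCoord_right hs t))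
    ((continuousOn_const.mul h.contDiffOn_lin.continuousOn.comp_logCoord).conjLin
      (continuousOn_const.mul h.contDiffOn_conj.continuousOn.comp_logCoord).neg)
    ((continuousOn_const.mul (h.contDiffOn_lin.continuousOn_fderiv_apply 1).comp_logCoord).conjLin
      (continuousOn_const.mul (h.contDiffOn_conj.continuousOn_fderiv_apply 1).comp_logCoord).neg)
    (by
      intro s hs t
      have h1 := h.flat_lin (logCoord s t) (by simpa using hs)
      have h2 := h.flat_conj (logCoord s t) (by simpa using hs)
      simp only [radial, angular, conjLin_mul, conjLin_sub, conjLin_add, map_mul, map_neg,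
        Complex.conj_I]
      rw [← conjLin_zero]
      congr 1
      · linear_combination Complex.I * h1 - fderiv ℝ G (logCoord s t) Complex.I * Complex.I_mul_I
      · linear_combination -Complex.I * h2 -
          fderiv ℝ b (logCoord s t) Complex.I * Complex.I_mul_I)
    hΦ hΦ0 hs Real.two_pi_pos.le
  have hper : radial G b s (2 * Real.pi) = radial G b s 0 := by
    simp only [radial, logCoord_two_pi, h.periodic_lin, h.periodic_conj]
  rwa [hper] at key

theorem hasDerivAt_linCoeff_holonomy (h : IsFlatStrip S G b) {Φ : ℝ → ℝ → ℂ →L[ℝ] ℂ}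
    (hΦ0 : ∀ s < S, Φ s 0 = 1)
    (hΦ : ∀ s < S, ∀ t, HasDerivAt (Φ s) (-(angular G b s t * Φ s t)) t) {s : ℝ} (hs : s < S) :
    HasDerivAt (fun s => linCoeff (Φ s (2 * Real.pi)))
      (conjCoeff (Φ s (2 * Real.pi)) * conj (b (logCoord s 0)) -
        b (logCoord s 0) * conj (conjCoeff (Φ s (2 * Real.pi)))) s := by
  have := (h.hasDerivAt_holonomy hΦ0 hΦ hs).linCoeff
  convert! this using 1
  nth_rw 3 4 [← conjLin_coeff (Φ s (2 * Real.pi))]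
  rw [radial, conjLin_mul, conjLin_mul, conjLin_sub, linCoeff_conjLin]
  ring

theorem hasDerivAt_conjCoeff_holonomy (h : IsFlatStrip S G b) {Φ : ℝ → ℝ → ℂ →L[ℝ] ℂ}
    (hΦ0 : ∀ s < S, Φ s 0 = 1)
    (hΦ : ∀ s < S, ∀ t, HasDerivAt (Φ s) (-(angular G b s t * Φ s t)) t) {s : ℝ} (hs : s < S) :
    HasDerivAt (fun s => conjCoeff (Φ s (2 * Real.pi)))
      ((linCoeff (Φ s (2 * Real.pi)) - conj (linCoeff (Φ s (2 * Real.pi)))) * b (logCoord s 0) +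
        conjCoeff (Φ s (2 * Real.pi)) * (conj (G (logCoord s 0)) - G (logCoord s 0))) s := by
  have := (h.hasDerivAt_holonomy hΦ0 hΦ hs).conjCoeff
  convert! this using 1
  nth_rw 4 5 [← conjLin_coeff (Φ s (2 * Real.pi))]
  rw [radial, conjLin_mul, conjLin_mul, conjLin_sub, conjCoeff_conjLin]
  ring

end IsFlatStrip
end

/-! ### Limit of the holonomy at the puncture -/

section

open ComplexConjugate

theorem HasDerivAt.antitoneOn_Iio {f f' : ℝ → ℝ} {S : ℝ} (hf : ∀ s < S, HasDerivAt f (f' s) s)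
    (hf' : ∀ s < S, f' s ≤ 0) : AntitoneOn f (Iio S) := by
  refine antitoneOn_of_deriv_nonpos (convex_Iio S)
    (fun s hs => (hf s hs).continuousAt.continuousWithinAt) ?_ ?_
  · rw [interior_Iio]
    exact fun s hs => (hf s hs).differentiableAt.differentiableWithinAt
  · rw [interior_Iio]
    intro s hs
    rw [(hf s hs).deriv]
    exact hf' s hs

theorem AntitoneOn.le_of_tendsto_atBot {f : ℝ → ℝ} {S c s : ℝ} (hf : AntitoneOn f (Iio S))
    (hc : Tendsto f atBot (𝓝 c)) (hs : s < S) : f s ≤ c := by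
  refine ge_of_tendsto hc ?_
  filter_upwards [eventually_le_atBot s] with x hx
  exact hf (hx.trans_lt hs) hs hx

theorem eq_of_hasDerivAt_zero_of_tendsto_atBot {f : ℝ → ℝ} {S c s : ℝ}
    (hf : ∀ s < S, HasDerivAt f 0 s) (hc : Tendsto f atBot (𝓝 c)) (hs : s < S) : f s = c := by
  refine le_antisymm ((HasDerivAt.antitoneOn_Iio hf fun _ _ => le_rfl).le_of_tendsto_atBot hc hs) ?_
  have := (HasDerivAt.antitoneOn_Iio (f := fun x => -f x) (f' := fun _ => 0)
    (fun s hs => by simpa using! (hf s hs).neg) fun _ _ => le_rfl).le_of_tendsto_atBot hc.neg hs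
  linarith

namespace IsFlatStrip

variable {S : ℝ} {G b : ℂ → ℂ}

/-- The holonomy is a rotation up to an error controlled by the size of the antilinear part of the
connection form. -/
theorem norm_exp_mul_transport_sub_le (h : IsFlatStrip S G b) {s : ℝ} (hs : s < S)
    {Φ : ℝ → ℂ →L[ℝ] ℂ} (hΦ0 : Φ 0 = 1) (hΦ : ∀ t, HasDerivAt Φ (-(angular G b s t * Φ t)) t)
    {η : ℝ} (hη : 0 < η) (hb : ∀ t, ‖b (logCoord s t)‖ ≤ η) (v : ℂ) :
    ‖Complex.exp (Complex.I * ∫ t in (0 : ℝ)..2 * Real.pi, G (logCoord s t)) *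
      Φ (2 * Real.pi) v - v‖ ≤ ‖v‖ * (Real.exp (2 * Real.pi * η) - 1) := by
  have hGc : Continuous fun t => G (logCoord s t) :=
    h.contDiffOn_lin.continuousOn.continuous_logCoord hs
  let g : ℝ → ℂ := fun x => ∫ t in (0 : ℝ)..x, G (logCoord s t)
  have hg : ∀ t, HasDerivAt g (G (logCoord s t)) t := fun t =>
    (hGc.integral_hasStrictDerivAt 0 t).hasDerivAt
  -- The exponential is an integrating factor for the complex linear part; only the antilinear term
  -- survives in `M'`, and since conjugation is isometric `‖M'‖ = ‖b‖ ‖M‖`.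
  let M : ℝ → ℂ := fun t => Complex.exp (Complex.I * g t) * Φ t v
  have hM : ∀ t, HasDerivAt M
      (Complex.exp (Complex.I * g t) * (Complex.I * b (logCoord s t) * conj (Φ t v))) t := by
    intro t
    have h1 : HasDerivAt (fun t => Φ t v) (-(angular G b s t * Φ t) v) t := by
      simpa using (hΦ t).clm_apply (hasDerivAt_const t v)
    have h2 := ((hg t).const_mul Complex.I).cexp.mul h1
    convert! h2 using 1
    simp only [ContinuousLinearMap.mul_def, ContinuousLinearMap.comp_apply, angular, conjLin_apply]
    ring
  have hM0 : M 0 = v := by simp [M, g, hΦ0]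
  have hbd := norm_le_gronwallBound_of_norm_deriv_right_le (f := fun t => M t - v)
    (f' := fun t => Complex.exp (Complex.I * g t) *
      (Complex.I * b (logCoord s t) * conj (Φ t v)))
    (δ := 0) (K := η) (ε := η * ‖v‖) (a := 0) (b := 2 * Real.pi)
    (fun t _ => ((hM t).sub_const v).continuousAt.continuousWithinAt)
    (fun t _ => ((hM t).sub_const v).hasDerivWithinAt) (by simp [hM0]) (by
      intro t _
      have e1 : ‖Complex.exp (Complex.I * g t) * (Complex.I * b (logCoord s t) * conj (Φ t v))‖
          = ‖b (logCoord s t)‖ * ‖M t‖ := by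
        simp only [M, norm_mul, Complex.norm_I, one_mul, RCLike.norm_conj]
        ring
      rw [e1]
      have e2 : ‖M t‖ ≤ ‖M t - v‖ + ‖v‖ := by
        simpa using norm_add_le (M t - v) v
      calc ‖b (logCoord s t)‖ * ‖M t‖ ≤ η * (‖M t - v‖ + ‖v‖) :=
            mul_le_mul (hb t) e2 (norm_nonneg _) hη.le
        _ = η * ‖M t - v‖ + η * ‖v‖ := by ring)
    (2 * Real.pi) ⟨Real.two_pi_pos.le, le_rfl⟩
  rw [gronwallBound_of_K_ne_0 hη.ne'] at hbd
  refine hbd.trans (le_of_eq ?_)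
  simp only [sub_zero, zero_mul, zero_add]
  rw [mul_comm η (2 * Real.pi)]
  field_simp

/-- Taking `v = 1` and `v = i` determines a real linear map, and both coefficients are averages of
the two resulting errors. -/
theorem norm_coeff_holonomy_le (h : IsFlatStrip S G b) {s : ℝ} (hs : s < S)
    {Φ : ℝ → ℂ →L[ℝ] ℂ} (hΦ0 : Φ 0 = 1) (hΦ : ∀ t, HasDerivAt Φ (-(angular G b s t * Φ t)) t)
    {η : ℝ} (hη : 0 < η) (hb : ∀ t, ‖b (logCoord s t)‖ ≤ η) :
    ‖Complex.exp (Complex.I * ∫ t in (0 : ℝ)..2 * Real.pi, G (logCoord s t)) *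
      linCoeff (Φ (2 * Real.pi)) - 1‖ ≤ Real.exp (2 * Real.pi * η) - 1 ∧
    ‖Complex.exp (Complex.I * ∫ t in (0 : ℝ)..2 * Real.pi, G (logCoord s t)) *
      conjCoeff (Φ (2 * Real.pi))‖ ≤ Real.exp (2 * Real.pi * η) - 1 := by
  have h1 := h.norm_exp_mul_transport_sub_le hs hΦ0 hΦ hη hb 1
  have h2 := h.norm_exp_mul_transport_sub_le hs hΦ0 hΦ hη hb Complex.I
  rw [norm_one, one_mul] at h1
  rw [Complex.norm_I, one_mul] at h2
  set e := Complex.exp (Complex.I * ∫ t in (0 : ℝ)..2 * Real.pi, G (logCoord s t))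
  set T := Φ (2 * Real.pi)
  have e1 : e * linCoeff T - 1 =
      ((e * T 1 - 1) - Complex.I * (e * T Complex.I - Complex.I)) / 2 := by
    rw [linCoeff]
    linear_combination (-1 / 2 : ℂ) * Complex.I_mul_I
  have e2 : e * conjCoeff T = ((e * T 1 - 1) + Complex.I * (e * T Complex.I - Complex.I)) / 2 := by
    rw [conjCoeff]
    linear_combination (1 / 2 : ℂ) * Complex.I_mul_I
  have h3 : ‖Complex.I * (e * T Complex.I - Complex.I)‖ ≤ Real.exp (2 * Real.pi * η) - 1 := by
    rwa [norm_mul, Complex.norm_I, one_mul]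
  constructor
  · rw [e1, norm_div, Complex.norm_two, div_le_iff₀ two_pos]
    linarith [norm_sub_le (e * T 1 - 1) (Complex.I * (e * T Complex.I - Complex.I))]
  · rw [e2, norm_div, Complex.norm_two, div_le_iff₀ two_pos]
    linarith [norm_add_le (e * T 1 - 1) (Complex.I * (e * T Complex.I - Complex.I))]

/-- The limit of the holonomy around shrinking circles. -/
theorem tendsto_coeff_holonomy (h : IsFlatStrip S G b) {Φ : ℝ → ℝ → ℂ →L[ℝ] ℂ}
    (hΦ0 : ∀ s < S, Φ s 0 = 1)
    (hΦ : ∀ s < S, ∀ t, HasDerivAt (Φ s) (-(angular G b s t * Φ s t)) t)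
    (hb : Tendsto b (comap Complex.re atBot) (𝓝 0)) {c : ℂ}
    (hc : Tendsto (fun s => ∫ t in (0 : ℝ)..2 * Real.pi, G (logCoord s t)) atBot (𝓝 c)) :
    Tendsto (fun s => linCoeff (Φ s (2 * Real.pi))) atBot (𝓝 (Complex.exp (-(Complex.I * c)))) ∧
      Tendsto (fun s => conjCoeff (Φ s (2 * Real.pi))) atBot (𝓝 0) := by
  have hsmall : ∀ ε > 0, ∀ᶠ s in atBot,
      ‖Complex.exp (Complex.I * ∫ t in (0 : ℝ)..2 * Real.pi, G (logCoord s t)) *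
        linCoeff (Φ s (2 * Real.pi)) - 1‖ < ε ∧
      ‖Complex.exp (Complex.I * ∫ t in (0 : ℝ)..2 * Real.pi, G (logCoord s t)) *
        conjCoeff (Φ s (2 * Real.pi))‖ < ε := by
    intro ε hε
    obtain ⟨η, hη, hηε⟩ : ∃ η > 0, Real.exp (2 * Real.pi * η) - 1 < ε := by
      have hcont : Tendsto (fun η : ℝ => Real.exp (2 * Real.pi * η) - 1) (𝓝[>] 0) (𝓝 0) := by
        have : Continuous fun η : ℝ => Real.exp (2 * Real.pi * η) - 1 := by fun_prop
        simpa using (this.tendsto 0).mono_left nhdsWithin_le_nhds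
      obtain ⟨η, h1, h2⟩ := ((hcont.eventually (gt_mem_nhds hε)).and self_mem_nhdsWithin).exists
      exact ⟨η, h2, h1⟩
    have hbη : ∀ᶠ s in atBot, ∀ t, ‖b (logCoord s t)‖ ≤ η := by
      have h1 : ∀ᶠ σ in comap Complex.re atBot, ‖b σ‖ < η := by
        simpa using hb.norm.eventually (gt_mem_nhds (by simpa using hη))
      rw [eventually_comap] at h1
      filter_upwards [h1] with s hs t
      exact (hs _ (logCoord_re s t)).le
    filter_upwards [hbη, eventually_lt_atBot S] with s hs hsS
    obtain ⟨h1, h2⟩ := h.norm_coeff_holonomy_le hsS (hΦ0 s hsS) (hΦ s hsS) hη hs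
    exact ⟨h1.trans_lt hηε, h2.trans_lt hηε⟩
  have hE : Tendsto (fun s => Complex.exp (-(Complex.I *
      ∫ t in (0 : ℝ)..2 * Real.pi, G (logCoord s t)))) atBot (𝓝 (Complex.exp (-(Complex.I * c)))) :=
    (Complex.continuous_exp.tendsto _).comp (hc.const_mul Complex.I).neg
  have hcancel : ∀ x y : ℂ, Complex.exp (-x) * (Complex.exp x * y) = y := by
    intro x y
    rw [← mul_assoc, ← Complex.exp_add]
    simp
  constructor
  · have h1 : Tendsto (fun s => Complex.exp (Complex.I *
        ∫ t in (0 : ℝ)..2 * Real.pi, G (logCoord s t)) * linCoeff (Φ s (2 * Real.pi)))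
        atBot (𝓝 1) := by
      rw [Metric.tendsto_nhds]
      intro ε hε
      filter_upwards [hsmall ε hε] with s hs
      rw [dist_eq_norm]
      exact hs.1
    simpa [hcancel] using hE.mul h1
  · have h1 : Tendsto (fun s => Complex.exp (Complex.I *
        ∫ t in (0 : ℝ)..2 * Real.pi, G (logCoord s t)) * conjCoeff (Φ s (2 * Real.pi)))
        atBot (𝓝 0) := by
      rw [Metric.tendsto_nhds]
      intro ε hε
      filter_upwards [hsmall ε hε] with s hs
      rw [dist_eq_norm, sub_zero]
      exact hs.2
    simpa [hcancel] using hE.mul h1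

/-- If `G` is the logarithmic derivative of a periodic conformal factor `exp (2 l)` which behaves
like `exp (β s)` at the puncture, then the integral of `G` over circles tends to `π β`. -/
theorem tendsto_integral_lin (h : IsFlatStrip S G b) {l : ℂ → ℝ}
    (hl : ∀ σ : ℂ, σ.re < S → ∃ L : ℂ →L[ℝ] ℝ, HasFDerivAt l L σ ∧ ∀ v, L v = (G σ * v).re)
    (hlp : ∀ σ, l (σ + 2 * Real.pi * Complex.I) = l σ) {β : ℝ}
    (hβ : Tendsto (fun σ => l σ / σ.re) (comap Complex.re atBot) (𝓝 (β / 2))) :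
    Tendsto (fun s => ∫ t in (0 : ℝ)..2 * Real.pi, G (logCoord s t)) atBot
      (𝓝 ((Real.pi * β : ℝ) : ℂ)) := by
  have hls : ∀ s < S, ∀ t, HasDerivAt (fun s => l (logCoord s t)) (G (logCoord s t)).re s := by
    intro s hs t
    obtain ⟨L, hL, hLv⟩ := hl (logCoord s t) (by simpa using hs)
    have := hL.comp_hasDerivAt s (hasDerivAt_logCoord_left s t)
    rwa [hLv, mul_one] at this
  have hlt : ∀ s < S, ∀ t, HasDerivAt (fun t => l (logCoord s t)) (-(G (logCoord s t)).im) t := by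
    intro s hs t
    obtain ⟨L, hL, hLv⟩ := hl (logCoord s t) (by simpa using hs)
    have := hL.comp_hasDerivAt t (hasDerivAt_logCoord_right s t)
    rwa [hLv, Complex.mul_I_re] at this
  have hGc : ∀ s < S, Continuous fun t => G (logCoord s t) := fun s hs =>
    h.contDiffOn_lin.continuousOn.continuous_logCoord hs
  have hre : ∀ s < S, (∫ t in (0 : ℝ)..2 * Real.pi, G (logCoord s t)).re =
      ∫ t in (0 : ℝ)..2 * Real.pi, (G (logCoord s t)).re := fun s hs => by
    simpa using! (Complex.reCLM.intervalIntegral_comp_comm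
      ((hGc s hs).intervalIntegrable 0 (2 * Real.pi))).symm
  -- `Im G` is minus the `t`-derivative of the periodic function `l`.
  have him : ∀ s < S, (∫ t in (0 : ℝ)..2 * Real.pi, G (logCoord s t)).im = 0 := fun s hs => by
    have h1 := Complex.imCLM.intervalIntegral_comp_comm
      ((hGc s hs).intervalIntegrable (μ := MeasureTheory.volume) 0 (2 * Real.pi))
    have h2 := intervalIntegral.integral_eq_sub_of_hasDerivAt (a := 0) (b := 2 * Real.pi)
      (fun t _ => (hlt s hs t))
      ((Complex.continuous_im.comp (hGc s hs)).neg.intervalIntegrable _ _)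
    rw [logCoord_two_pi, hlp, sub_self, intervalIntegral.integral_neg, neg_eq_zero] at h2
    exact h1.symm.trans h2
  have hlc : ∀ s < S, Continuous fun t => l (logCoord s t) := fun s hs =>
    continuous_iff_continuousAt.2 fun t => (hlt s hs t).continuousAt
  let φ : ℝ → ℝ := fun s => ∫ t in (0 : ℝ)..2 * Real.pi, (G (logCoord s t)).re
  have hφ : ∀ s < S, HasDerivAt φ
      (∫ t in (0 : ℝ)..2 * Real.pi, (fderiv ℝ G (logCoord s t) 1).re) s := fun s hs =>
    hasDerivAt_integral_of_continuousOn (f := fun s t => (G (logCoord s t)).re)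
      (f' := fun s t => (fderiv ℝ G (logCoord s t) 1).re) hs Real.two_pi_pos
      (fun s hs t => Complex.reCLM.hasFDerivAt.comp_hasDerivAt s
        (h.contDiffOn_lin.hasDerivAt_logCoord_left hs t))
      (fun s hs => Complex.continuous_re.comp (hGc s hs))
      (Complex.continuous_re.comp_continuousOn
        (h.contDiffOn_lin.continuousOn_fderiv_apply 1)).comp_logCoord
  -- The real part of `flat_lin` is `∂_s Re G - ∂_t Im G = -2 |b|²`, that is, `l` is superharmonic;
  -- the `t`-derivative integrates to zero by periodicity.
  have hφ' : ∀ s < S, ∫ t in (0 : ℝ)..2 * Real.pi, (fderiv ℝ G (logCoord s t) 1).re ≤ 0 := by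
    intro s hs
    have hIc : Continuous fun t => (fderiv ℝ G (logCoord s t) Complex.I).im :=
      Complex.continuous_im.comp
        ((h.contDiffOn_lin.continuousOn_fderiv_apply Complex.I).continuous_logCoord hs)
    have h0 := intervalIntegral.integral_eq_sub_of_hasDerivAt (a := 0) (b := 2 * Real.pi)
      (f := fun t => (G (logCoord s t)).im)
      (fun t _ => Complex.imCLM.hasFDerivAt.comp_hasDerivAt t
        (h.contDiffOn_lin.hasDerivAt_logCoord_right hs t)) (hIc.intervalIntegrable _ _)
    rw [logCoord_two_pi, h.periodic_lin, sub_self] at h0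
    refine le_trans (intervalIntegral.integral_mono_on Real.two_pi_pos.le
      ((Complex.continuous_re.comp ((h.contDiffOn_lin.continuousOn_fderiv_apply
        1).continuous_logCoord hs)).intervalIntegrable _ _) (hIc.intervalIntegrable _ _) ?_) h0.le
    intro t _
    have h1 := congrArg Complex.re (h.flat_lin (logCoord s t) (by simpa using hs))
    rw [Complex.mul_conj] at h1
    have h2 := Complex.normSq_nonneg (b (logCoord s t))
    simp at h1 ⊢
    linarith
  let Λ : ℝ → ℝ := fun s => ∫ t in (0 : ℝ)..2 * Real.pi, l (logCoord s t)
  have hΛ : ∀ s < S, HasDerivAt Λ (φ s) s := fun s hs =>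
    hasDerivAt_integral_of_continuousOn (f := fun s t => l (logCoord s t))
      (f' := fun s t => (G (logCoord s t)).re) hs Real.two_pi_pos hls hlc
      (Complex.continuous_re.comp_continuousOn h.contDiffOn_lin.continuousOn).comp_logCoord
  -- The filter `comap Complex.re atBot` makes `hβ` uniform in `t`, so the limit passes through the
  -- integral over a length `2π`.
  have hΛβ : Tendsto (fun s => Λ s / s) atBot (𝓝 (Real.pi * β)) := by
    rw [Metric.tendsto_nhds]
    intro ε hε
    have hε' : 0 < ε / (4 * Real.pi) := by positivity
    have h1 := (Metric.tendsto_nhds.1 hβ) _ hε'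
    rw [eventually_comap] at h1
    filter_upwards [h1, eventually_lt_atBot S] with s hs hsS
    have h2 : Λ s / s - Real.pi * β =
        ∫ t in (0 : ℝ)..2 * Real.pi, (l (logCoord s t) / s - β / 2) := by
      rw [intervalIntegral.integral_sub ((hlc s hsS).div_const s |>.intervalIntegrable _ _)
        (continuous_const.intervalIntegrable _ _), intervalIntegral.integral_div,
        intervalIntegral.integral_const]
      simp only [sub_zero, smul_eq_mul, Λ]
      ring
    rw [Real.dist_eq, h2]
    have h3 := intervalIntegral.norm_integral_le_of_norm_le_const (a := 0) (b := 2 * Real.pi)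
      (f := fun t => l (logCoord s t) / s - β / 2) (C := ε / (4 * Real.pi)) (fun t _ => by
        have := hs (logCoord s t) (logCoord_re s t)
        rw [logCoord_re, Real.dist_eq] at this
        exact this.le)
    rw [Real.norm_eq_abs, sub_zero, abs_of_pos Real.two_pi_pos] at h3
    refine h3.trans_lt ?_
    have hpi := Real.pi_pos
    rw [show ε / (4 * Real.pi) * (2 * Real.pi) = ε / 2 by field_simp; ring]
    linarith
  have hlim : Tendsto φ atBot (𝓝 (Real.pi * β)) :=
    tendsto_deriv_atBot_of_antitoneOn hΛ (HasDerivAt.antitoneOn_Iio hφ hφ') hΛβ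
  refine ((Complex.continuous_ofReal.tendsto _).comp hlim).congr' ?_
  filter_upwards [eventually_lt_atBot S] with s hs
  apply Complex.ext
  · simp [φ, hre s hs]
  · simp [him s hs]

end IsFlatStrip

end

/-! ### Conserved quantities and rigidity of the holonomy -/

section

open ComplexConjugate

/-- A nonnegative function with `y' ≤ g y`, where `g` decays exponentially at `-∞`, vanishes if it
tends to zero at `-∞`. -/
theorem eq_zero_of_deriv_le_of_tendsto_atBot {y y' g : ℝ → ℝ} {S s₀ K δ : ℝ} (hs₀ : s₀ ≤ S)
    (hδ : 0 < δ) (hy0 : ∀ s, 0 ≤ y s) (hy : ∀ s < S, HasDerivAt y (y' s) s)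
    (hy' : ∀ s < S, |y' s| ≤ g s * y s) (hgc : ContinuousOn g (Iio S))
    (hg : ∀ s < s₀, g s ≤ K * Real.exp (δ * s)) (hlim : Tendsto y atBot (𝓝 0)) {s : ℝ}
    (hs : s < S) : y s = 0 := by
  -- This is `exp (-∫ K exp (δ τ) dτ)` over `(-∞, s]`. It tends to `1` at `-∞`, so `y * e` is
  -- antitone below `s₀` and starts from the limit `0`.
  let e : ℝ → ℝ := fun s => Real.exp (-(K / δ * Real.exp (δ * s)))
  have he : ∀ s, HasDerivAt e (e s * -(K * Real.exp (δ * s))) s := by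
    intro s
    have h1 : HasDerivAt (fun s : ℝ => δ * s) (δ * 1) s := (hasDerivAt_id s).const_mul δ
    have h2 : HasDerivAt (fun s => -(K / δ * Real.exp (δ * s))) (-(K * Real.exp (δ * s))) s := by
      convert! (h1.exp.const_mul (K / δ)).neg using 1
      field_simp
    exact h2.exp
  have hf : ∀ s < s₀, HasDerivAt (fun s => y s * e s)
      (y' s * e s + y s * (e s * -(K * Real.exp (δ * s)))) s :=
    fun s hs => (hy s (hs.trans_le hs₀)).mul (he s)
  have hfa : AntitoneOn (fun s => y s * e s) (Iio s₀) := by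
    refine HasDerivAt.antitoneOn_Iio hf fun s hs => ?_
    have h1 := (abs_le.1 (hy' s (hs.trans_le hs₀))).2
    have h2 := mul_le_mul_of_nonneg_right (hg s hs) (hy0 s)
    have h3 : (y' s - K * Real.exp (δ * s) * y s) * e s ≤ 0 :=
      mul_nonpos_of_nonpos_of_nonneg (by linarith) (Real.exp_pos _).le
    linarith
  have helim : Tendsto e atBot (𝓝 1) := by
    have h1 : Tendsto (fun s : ℝ => δ * s) atBot atBot := tendsto_id.const_mul_atBot hδ
    have h2 : Tendsto (fun s : ℝ => -(K / δ * Real.exp (δ * s))) atBot (𝓝 0) := by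
      simpa using ((Real.tendsto_exp_atBot.comp h1).const_mul (K / δ)).neg
    simpa using! (Real.continuous_exp.tendsto 0).comp h2
  have hflim : Tendsto (fun s => y s * e s) atBot (𝓝 0) := by simpa using hlim.mul helim
  have hlow : ∀ s < s₀, y s = 0 := by
    intro s hs
    have h1 := hfa.le_of_tendsto_atBot hflim hs
    have h2 : y s ≤ 0 := by
      by_contra hpos
      push Not at hpos
      exact absurd h1 (not_le.2 (mul_pos hpos (Real.exp_pos _)))
    exact le_antisymm h2 (hy0 s)
  rcases lt_or_ge s s₀ with h | h
  · exact hlow s h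
  -- Past `s₀` the exponential bound is not available; `g` is bounded on the compact interval, and
  -- uniqueness propagates the zero value from `s₀ - 1`.
  · have hsub : Icc (s₀ - 1) s ⊆ Iio S := fun x hx => hx.2.trans_lt hs
    obtain ⟨C, hC⟩ := (isCompact_Icc (a := s₀ - 1) (b := s)).exists_bound_of_continuousOn
      (hgc.mono hsub)
    refine eq_zero_of_abs_deriv_le_mul_abs_self_of_eq_zero_right (f := y) (f' := y') (K := C)
      (a := s₀ - 1) (b := s) (fun x hx => (hy x (hsub hx)).continuousAt.continuousWithinAt)
      (fun x hx => (hy x (hsub ⟨hx.1, hx.2.le⟩)).hasDerivWithinAt)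
      (hlow _ (by linarith)) (fun x hx => ?_) s ⟨by linarith, le_rfl⟩
    have hx' : x ∈ Icc (s₀ - 1) s := ⟨hx.1, hx.2.le⟩
    refine (hy' x (hsub hx')).trans ?_
    rw [Real.norm_eq_abs, abs_of_nonneg (hy0 x)]
    exact mul_le_mul_of_nonneg_right ((le_abs_self _).trans (hC x hx')) (hy0 x)

namespace IsFlatStrip

variable {S : ℝ} {G b : ℂ → ℂ} {Φ : ℝ → ℝ → ℂ →L[ℝ] ℂ}

/-- The term `Ḡ - G` is purely imaginary, so it rotates the antilinear coefficient without changing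
its modulus. What remains equals the derivative of the square of `Im α`; with `Re α` constant, this
conserves `|α|² - |β|²`. -/
theorem hasDerivAt_normSq_conjCoeff (h : IsFlatStrip S G b) (hΦ0 : ∀ s < S, Φ s 0 = 1)
    (hΦ : ∀ s < S, ∀ t, HasDerivAt (Φ s) (-(angular G b s t * Φ s t)) t) {s : ℝ} (hs : s < S) :
    HasDerivAt (fun s => (conjCoeff (Φ s (2 * Real.pi))).re ^ 2 +
        (conjCoeff (Φ s (2 * Real.pi))).im ^ 2)
      (4 * (linCoeff (Φ s (2 * Real.pi))).im *
        (conjCoeff (Φ s (2 * Real.pi)) * conj (b (logCoord s 0))).im) s := by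
  have h1 := h.hasDerivAt_conjCoeff_holonomy hΦ0 hΦ hs
  have hre := Complex.reCLM.hasFDerivAt.comp_hasDerivAt s h1
  have him := Complex.imCLM.hasFDerivAt.comp_hasDerivAt s h1
  convert! (hre.pow 2).add (him.pow 2) using 1
  simp
  ring

theorem hasDerivAt_linCoeff_re (h : IsFlatStrip S G b) (hΦ0 : ∀ s < S, Φ s 0 = 1)
    (hΦ : ∀ s < S, ∀ t, HasDerivAt (Φ s) (-(angular G b s t * Φ s t)) t) {s : ℝ} (hs : s < S) :
    HasDerivAt (fun s => (linCoeff (Φ s (2 * Real.pi))).re) 0 s := by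
  convert! Complex.reCLM.hasFDerivAt.comp_hasDerivAt s
    (h.hasDerivAt_linCoeff_holonomy hΦ0 hΦ hs) using 1
  simp
  ring

theorem hasDerivAt_linCoeff_im (h : IsFlatStrip S G b) (hΦ0 : ∀ s < S, Φ s 0 = 1)
    (hΦ : ∀ s < S, ∀ t, HasDerivAt (Φ s) (-(angular G b s t * Φ s t)) t) {s : ℝ} (hs : s < S) :
    HasDerivAt (fun s => (linCoeff (Φ s (2 * Real.pi))).im)
      (2 * (conjCoeff (Φ s (2 * Real.pi)) * conj (b (logCoord s 0))).im) s := by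
  convert! Complex.imCLM.hasFDerivAt.comp_hasDerivAt s
    (h.hasDerivAt_linCoeff_holonomy hΦ0 hΦ hs) using 1
  simp
  ring

/-- Half the trace of the holonomy: constant in `s`, hence equal to its limit at the puncture. The
next lemma does the same for the determinant. -/
theorem linCoeff_re_eq (h : IsFlatStrip S G b) (hΦ0 : ∀ s < S, Φ s 0 = 1)
    (hΦ : ∀ s < S, ∀ t, HasDerivAt (Φ s) (-(angular G b s t * Φ s t)) t) {θ : ℝ}
    (hα : Tendsto (fun s => linCoeff (Φ s (2 * Real.pi))) atBot
      (𝓝 (Complex.exp (-(Complex.I * θ))))) {s : ℝ} (hs : s < S) :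
    (linCoeff (Φ s (2 * Real.pi))).re = Real.cos θ := by
  have h1 := (Complex.continuous_re.tendsto _).comp hα
  have h2 : (Complex.exp (-(Complex.I * θ))).re = Real.cos θ := by
    rw [show -(Complex.I * θ) = ((-θ : ℝ) : ℂ) * Complex.I by push_cast; ring,
      Complex.exp_ofReal_mul_I_re, Real.cos_neg]
  rw [h2] at h1
  exact eq_of_hasDerivAt_zero_of_tendsto_atBot
    (f := fun s => (linCoeff (Φ s (2 * Real.pi))).re)
    (fun s hs => h.hasDerivAt_linCoeff_re hΦ0 hΦ hs) h1 hs

theorem normSq_linCoeff_sub_eq (h : IsFlatStrip S G b) (hΦ0 : ∀ s < S, Φ s 0 = 1)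
    (hΦ : ∀ s < S, ∀ t, HasDerivAt (Φ s) (-(angular G b s t * Φ s t)) t) {θ : ℝ}
    (hα : Tendsto (fun s => linCoeff (Φ s (2 * Real.pi))) atBot
      (𝓝 (Complex.exp (-(Complex.I * θ)))))
    (hβ : Tendsto (fun s => conjCoeff (Φ s (2 * Real.pi))) atBot (𝓝 0)) {s : ℝ} (hs : s < S) :
    Complex.normSq (linCoeff (Φ s (2 * Real.pi))) -
      Complex.normSq (conjCoeff (Φ s (2 * Real.pi))) = 1 := by
  have h1 := ((Complex.continuous_normSq.tendsto _).comp hα).sub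
    ((Complex.continuous_normSq.tendsto _).comp hβ)
  have h2 : Complex.normSq (Complex.exp (-(Complex.I * θ))) = 1 := by
    rw [Complex.normSq_eq_norm_sq, show -(Complex.I * θ) = ((-θ : ℝ) : ℂ) * Complex.I by
      push_cast; ring, Complex.norm_exp_ofReal_mul_I, one_pow]
  rw [h2, map_zero, sub_zero] at h1
  refine eq_of_hasDerivAt_zero_of_tendsto_atBot
    (f := fun s => Complex.normSq (linCoeff (Φ s (2 * Real.pi))) -
      Complex.normSq (conjCoeff (Φ s (2 * Real.pi)))) (fun s hs => ?_) h1 hs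
  convert! (((h.hasDerivAt_linCoeff_re hΦ0 hΦ hs).pow 2).add
    ((h.hasDerivAt_linCoeff_im hΦ0 hΦ hs).pow 2)).sub
    (h.hasDerivAt_normSq_conjCoeff hΦ0 hΦ hs) using 1
  · funext x
    simp [Complex.normSq_apply]
    ring
  · simp
    ring

/-- If the holonomies around shrinking circles tend to `± 1` and the antilinear part of the
connection is integrable at the puncture, the holonomy is a multiple of the identity. -/
theorem holonomy_eq_of_sin_eq_zero (h : IsFlatStrip S G b) (hΦ0 : ∀ s < S, Φ s 0 = 1)
    (hΦ : ∀ s < S, ∀ t, HasDerivAt (Φ s) (-(angular G b s t * Φ s t)) t) {θ : ℝ}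
    (hα : Tendsto (fun s => linCoeff (Φ s (2 * Real.pi))) atBot
      (𝓝 (Complex.exp (-(Complex.I * θ)))))
    (hβ : Tendsto (fun s => conjCoeff (Φ s (2 * Real.pi))) atBot (𝓝 0))
    (hθ : Real.sin θ = 0) {K δ s₀ : ℝ} (hδ : 0 < δ)
    (hb : ∀ σ : ℂ, σ.re < s₀ → ‖b σ‖ ≤ K * Real.exp (δ * σ.re)) {s : ℝ} (hs : s < S) :
    (linCoeff (Φ s (2 * Real.pi))).im = 0 ∧ conjCoeff (Φ s (2 * Real.pi)) = 0 := by
  -- `y` vanishes exactly when the holonomy is a real scalar.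
  let y : ℝ → ℝ := fun s => (linCoeff (Φ s (2 * Real.pi))).im ^ 2 +
    ((conjCoeff (Φ s (2 * Real.pi))).re ^ 2 + (conjCoeff (Φ s (2 * Real.pi))).im ^ 2)
  have hy0 : ∀ s, 0 ≤ y s := fun s => by positivity
  have hlim : Tendsto y atBot (𝓝 0) := by
    have h1 := (Complex.continuous_im.tendsto _).comp hα
    have h2 := (Complex.continuous_re.tendsto _).comp hβ
    have h3 := (Complex.continuous_im.tendsto _).comp hβ
    have h4 : (Complex.exp (-(Complex.I * θ))).im = 0 := by
      rw [show -(Complex.I * θ) = ((-θ : ℝ) : ℂ) * Complex.I by push_cast; ring,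
        Complex.exp_ofReal_mul_I_im, Real.sin_neg, hθ, neg_zero]
    rw [h4] at h1
    simpa using (h1.pow 2).add ((h2.pow 2).add (h3.pow 2))
  -- Both squares contribute `4 Im α Im (β b̄)` to `y'`, so `|y'| ≤ 8 |Im α| |β| |b| ≤ 8 |b| y`.
  have hzero : y s = 0 := by
    refine eq_zero_of_deriv_le_of_tendsto_atBot (y := y) (S := S) (s₀ := min s₀ S)
      (K := 8 * K) (δ := δ) (g := fun s => 8 * ‖b (logCoord s 0)‖)
      (min_le_right _ _) hδ hy0
      (fun s hs => ((h.hasDerivAt_linCoeff_im hΦ0 hΦ hs).pow 2).add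
        (h.hasDerivAt_normSq_conjCoeff hΦ0 hΦ hs)) ?_ ?_ ?_ hlim hs
    · intro s _
      set α := linCoeff (Φ s (2 * Real.pi)) with hαd
      set β := conjCoeff (Φ s (2 * Real.pi)) with hβd
      set z := β * conj (b (logCoord s 0)) with hz
      have e1 : |z.im| ≤ ‖β‖ * ‖b (logCoord s 0)‖ := by
        refine (Complex.abs_im_le_norm z).trans (le_of_eq ?_)
        rw [hz, norm_mul, RCLike.norm_conj]
      have e2 : (‖β‖) ^ 2 = β.re ^ 2 + β.im ^ 2 := by
        rw [← Complex.normSq_eq_norm_sq, Complex.normSq_apply]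
        ring
      have e3 : y s = α.im ^ 2 + ‖β‖ ^ 2 := by rw [e2]
      have e4 : ((2 : ℕ) : ℝ) * α.im ^ (2 - 1) * (2 * z.im) + 4 * α.im * z.im =
          8 * (α.im * z.im) := by
        push_cast
        ring
      rw [e4, abs_mul, abs_mul, abs_of_pos (by norm_num : (0 : ℝ) < 8), e3]
      have e5 : |α.im| * |z.im| ≤ |α.im| * (‖β‖ * ‖b (logCoord s 0)‖) :=
        mul_le_mul_of_nonneg_left e1 (abs_nonneg _)
      have e6 : |α.im| * ‖β‖ ≤ α.im ^ 2 + ‖β‖ ^ 2 := by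
        rw [← sq_abs α.im]
        nlinarith [sq_nonneg (|α.im| - ‖β‖), sq_nonneg (|α.im|), sq_nonneg (‖β‖)]
      have e7 := mul_le_mul_of_nonneg_right e6 (norm_nonneg (b (logCoord s 0)))
      nlinarith
    · have : ContinuousOn (fun s : ℝ => logCoord s 0) (Iio S) := by
        unfold logCoord
        fun_prop
      exact continuousOn_const.mul (h.contDiffOn_conj.continuousOn.comp this
        (fun s hs => by simpa using hs)).norm
    · intro s hs
      have := hb (logCoord s 0) (by simpa using hs.trans_le (min_le_left _ _))
      rw [logCoord_re] at this
      linarith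
  have h1 : (linCoeff (Φ s (2 * Real.pi))).im ^ 2 = 0 := by
    nlinarith [sq_nonneg (linCoeff (Φ s (2 * Real.pi))).im,
      sq_nonneg (conjCoeff (Φ s (2 * Real.pi))).im, sq_nonneg (conjCoeff (Φ s (2 * Real.pi))).re]
  have h2 : (conjCoeff (Φ s (2 * Real.pi))).re ^ 2 = 0 := by
    nlinarith [sq_nonneg (linCoeff (Φ s (2 * Real.pi))).im,
      sq_nonneg (conjCoeff (Φ s (2 * Real.pi))).im, sq_nonneg (conjCoeff (Φ s (2 * Real.pi))).re]
  have h3 : (conjCoeff (Φ s (2 * Real.pi))).im ^ 2 = 0 := by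
    nlinarith [sq_nonneg (linCoeff (Φ s (2 * Real.pi))).im,
      sq_nonneg (conjCoeff (Φ s (2 * Real.pi))).im, sq_nonneg (conjCoeff (Φ s (2 * Real.pi))).re]
  rw [sq_eq_zero_iff] at h1 h2 h3
  exact ⟨h1, Complex.ext h2 h3⟩

end IsFlatStrip

end

/-! ### Holomorphic coordinates and coordinate vector fields -/

section Coordinates

variable {M : Type*} [TopologicalSpace M] [ChartedSpace ℂ M]

theorem contDiffGroupoid_complex_le {e : OpenPartialHomeomorph ℂ ℂ}
    (h : e ∈ contDiffGroupoid ω 𝓘(ℂ)) : e ∈ contDiffGroupoid ω 𝓘(ℝ, ℂ) := by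
  rw [contDiffGroupoid, mem_groupoid_of_pregroupoid] at h ⊢
  exact ⟨h.1.restrict_scalars ℝ, h.2.restrict_scalars ℝ⟩

theorem mem_maximalAtlas_real {z : OpenPartialHomeomorph M ℂ}
    (hz : z ∈ IsManifold.maximalAtlas 𝓘(ℂ) ω M) : z ∈ IsManifold.maximalAtlas 𝓘(ℝ, ℂ) ω M := by
  rw [IsManifold.maximalAtlas, mem_maximalAtlas_iff] at hz ⊢
  exact fun e he => ⟨contDiffGroupoid_complex_le (hz e he).1,
    contDiffGroupoid_complex_le (hz e he).2⟩

variable {z : OpenPartialHomeomorph M ℂ}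

theorem contMDiffAt_coord (hz : z ∈ IsManifold.maximalAtlas 𝓘(ℂ) ω M) {x : M}
    (hx : x ∈ z.source) : ContMDiffAt 𝓘(ℝ, ℂ) 𝓘(ℝ, ℂ) ω z x :=
  (contMDiffOn_of_mem_maximalAtlas (mem_maximalAtlas_real hz)).contMDiffAt
    (z.open_source.mem_nhds hx)

theorem contMDiffAt_coord_symm (hz : z ∈ IsManifold.maximalAtlas 𝓘(ℂ) ω M) {ζ : ℂ}
    (hζ : ζ ∈ z.target) : ContMDiffAt 𝓘(ℝ, ℂ) 𝓘(ℝ, ℂ) ω z.symm ζ :=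
  (contMDiffOn_symm_of_mem_maximalAtlas (mem_maximalAtlas_real hz)).contMDiffAt
    (z.open_target.mem_nhds hζ)

theorem mdifferentiable_coord (hz : z ∈ IsManifold.maximalAtlas 𝓘(ℂ) ω M) :
    z.MDifferentiable 𝓘(ℝ, ℂ) 𝓘(ℝ, ℂ) :=
  ⟨fun _ hx => ((contMDiffAt_coord hz hx).mdifferentiableAt (by simp)).mdifferentiableWithinAt,
    fun _ hx => ((contMDiffAt_coord_symm hz hx).mdifferentiableAt
      (by simp)).mdifferentiableWithinAt⟩

/-- The differential of a local coordinate. -/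
noncomputable def coordDiff (z : OpenPartialHomeomorph M ℂ) (x : M) : RTangent x →L[ℝ] ℂ :=
  mfderiv 𝓘(ℝ, ℂ) 𝓘(ℝ, ℂ) z x

/-- The differential of a holomorphic coordinate commutes with the complex structure. -/
theorem coordDiff_cxStr (hz : z ∈ IsManifold.maximalAtlas 𝓘(ℂ) ω M) {x : M}
    (hx : x ∈ z.source) (v : RTangent x) :
    coordDiff z x (cxStr x v) = Complex.I * coordDiff z x v := by
  have h1 : MDifferentiableAt 𝓘(ℂ) 𝓘(ℂ) z x :=
    ((contMDiffOn_of_mem_maximalAtlas hz).contMDiffAt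
      (z.open_source.mem_nhds hx)).mdifferentiableAt (by simp)
  have h2 := h1.hasMFDerivAt
  have h3 : HasMFDerivAt 𝓘(ℝ, ℂ) 𝓘(ℝ, ℂ) z x
      ((mfderiv 𝓘(ℂ) 𝓘(ℂ) z x : ℂ →L[ℂ] ℂ).restrictScalars ℝ) :=
    ⟨h2.1, HasFDerivWithinAt.restrictScalars ℝ h2.2⟩
  rw [coordDiff, h3.mfderiv]
  exact (mfderiv 𝓘(ℂ) 𝓘(ℂ) z x : ℂ →L[ℂ] ℂ).map_smul Complex.I v

theorem isInvertible_mfderiv_coord (hz : z ∈ IsManifold.maximalAtlas 𝓘(ℂ) ω M) {x : M}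
    (hx : x ∈ z.source) : (mfderiv 𝓘(ℝ, ℂ) 𝓘(ℝ, ℂ) z x).IsInvertible :=
  ⟨(mdifferentiable_coord hz).mfderiv hx, rfl⟩

theorem isInvertible_mfderiv_coord_symm (hz : z ∈ IsManifold.maximalAtlas 𝓘(ℂ) ω M) {ζ : ℂ}
    (hζ : ζ ∈ z.target) : (mfderiv 𝓘(ℝ, ℂ) 𝓘(ℝ, ℂ) z.symm ζ).IsInvertible :=
  ⟨(mdifferentiable_coord hz).symm.mfderiv hζ, rfl⟩

theorem coordDiff_coordField (hz : z ∈ IsManifold.maximalAtlas 𝓘(ℂ) ω M) {x : M}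
    (hx : x ∈ z.source) (u : ℂ) : coordDiff z x (coordField z u x) = u :=
  (isInvertible_mfderiv_coord hz hx).self_apply_inverse _

theorem coordField_coordDiff (hz : z ∈ IsManifold.maximalAtlas 𝓘(ℂ) ω M) {x : M}
    (hx : x ∈ z.source) (v : RTangent x) :
    coordField z (coordDiff z x v) x = v :=
  (isInvertible_mfderiv_coord hz hx).inverse_apply_self _

theorem coordDiff_injective (hz : z ∈ IsManifold.maximalAtlas 𝓘(ℂ) ω M) {x : M}
    (hx : x ∈ z.source) : Function.Injective (coordDiff z x) :=
  (mdifferentiable_coord hz).mfderiv_injective hx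

theorem cxStr_coordField (hz : z ∈ IsManifold.maximalAtlas 𝓘(ℂ) ω M) {x : M}
    (hx : x ∈ z.source) (u : ℂ) :
    cxStr x (coordField z u x) = coordField z (Complex.I * u) x := by
  apply coordDiff_injective hz hx
  rw [coordDiff_cxStr hz hx, coordDiff_coordField hz hx, coordDiff_coordField hz hx]

theorem coordField_add (z : OpenPartialHomeomorph M ℂ) (u v : ℂ) :
    coordField z (u + v) = coordField z u + coordField z v := by
  funext x
  exact map_add (mfderiv 𝓘(ℝ, ℂ) 𝓘(ℝ, ℂ) z x).inverse u v

theorem coordField_smul (z : OpenPartialHomeomorph M ℂ) (r : ℝ) (u : ℂ) :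
    coordField z (r • u) = r • coordField z u := by
  funext x
  exact map_smul (mfderiv 𝓘(ℝ, ℂ) 𝓘(ℝ, ℂ) z x).inverse r u

variable [IsManifold 𝓘(ℂ) ω M]

/-- `coordField z u` is the pullback of the constant field `u` under `z`; its smoothness, and below
the vanishing of brackets, come from naturality of pullback. -/
theorem vecSmoothAt_coordField (hz : z ∈ IsManifold.maximalAtlas 𝓘(ℂ) ω M) {x : M}
    (hx : x ∈ z.source) (u : ℂ) : VecSmoothAt (coordField z u) x := by
  have hV : ContMDiffAt 𝓘(ℝ, ℂ) (𝓘(ℝ, ℂ).prod 𝓘(ℝ, ℂ)) ∞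
      (fun y : ℂ => (⟨y, u⟩ : TangentBundle 𝓘(ℝ, ℂ) ℂ)) (z x) :=
    contMDiffAt_vectorSpace_iff_contDiffAt.2 contDiffAt_const
  exact ContMDiffAt.mpullback_vectorField_preimage (V := fun _ => u) hV (contMDiffAt_coord hz hx)
    (isInvertible_mfderiv_coord hz hx) (by simp)

theorem VecSmoothAt.vecDiffAt {X : (x : M) → RTangent x} {x : M} (h : VecSmoothAt X x) :
    VecDiffAt X x := ContMDiffAt.mdifferentiableAt h (by simp)

theorem mlieBracket_coordField (hz : z ∈ IsManifold.maximalAtlas 𝓘(ℂ) ω M) {x : M}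
    (hx : x ∈ z.source) (u v : ℂ) :
    VectorField.mlieBracket 𝓘(ℝ, ℂ) (coordField z u) (coordField z v) x = 0 := by
  have hV : ∀ u : ℂ, MDifferentiableAt 𝓘(ℝ, ℂ) (𝓘(ℝ, ℂ).prod 𝓘(ℝ, ℂ))
      (fun y : ℂ => (⟨y, u⟩ : TangentBundle 𝓘(ℝ, ℂ) ℂ)) (z x) := fun u =>
    (contMDiffAt_vectorSpace_iff_contDiffAt (n := 1).2 contDiffAt_const).mdifferentiableAt (by simp)
  have := VectorField.mpullback_mlieBracket (V := fun _ => u) (W := fun _ => v) (hV u) (hV v)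
    (contMDiffAt_coord hz hx) (by simp)
  refine Eq.trans this.symm ?_
  let V : ℂ → (y : ℂ) → TangentSpace 𝓘(ℝ, ℂ) y := fun u _ => u
  have hb : VectorField.mlieBracket 𝓘(ℝ, ℂ) (V u) (V v) (z x) = 0 := by
    rw [← VectorField.mlieBracketWithin_univ, VectorField.mlieBracketWithin_eq_lieBracketWithin]
    simp [VectorField.lieBracketWithin, V]
    rfl
  exact (congrArg _ hb).trans (map_zero _)

/-- The components of a smooth vector field are smooth functions of the coordinate. -/
theorem contDiffAt_coordDiff_comp_symm (hz : z ∈ IsManifold.maximalAtlas 𝓘(ℂ) ω M) {ζ : ℂ}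
    (hζ : ζ ∈ z.target) {X : (x : M) → RTangent x} (hX : VecSmoothAt X (z.symm ζ)) :
    ContDiffAt ℝ ∞ (fun η => coordDiff z (z.symm η) (X (z.symm η))) ζ := by
  have h1 := ContMDiffAt.mpullback_vectorField_preimage (V := X) hX (contMDiffAt_coord_symm hz hζ)
    (isInvertible_mfderiv_coord_symm hz hζ) (by simp)
  rw [contMDiffAt_vectorSpace_iff_contDiffAt] at h1
  refine h1.congr_of_eventuallyEq ?_
  filter_upwards [z.open_target.mem_nhds hζ] with η hη
  rw [VectorField.mpullback_apply]
  have h2 := (isInvertible_mfderiv_coord_symm hz hη).self_apply_inverse (X (z.symm η))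
  have h3 := (mdifferentiable_coord hz).comp_symm_deriv hη
  set v := (mfderiv 𝓘(ℝ, ℂ) 𝓘(ℝ, ℂ) z.symm η).inverse (X (z.symm η))
  rw [← h2]
  exact congrArg (fun L => L v) h3

/-- A vector field with smooth components is smooth. -/
theorem vecDiffAt_coordField_comp (hz : z ∈ IsManifold.maximalAtlas 𝓘(ℂ) ω M) {x : M}
    (hx : x ∈ z.source) {f : ℂ → ℂ} (hf : DifferentiableAt ℝ f (z x)) :
    VecDiffAt (fun y => coordField z (f (z y)) y) x := by
  have hV : MDifferentiableAt 𝓘(ℝ, ℂ) (𝓘(ℝ, ℂ).prod 𝓘(ℝ, ℂ))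
      (fun y : ℂ => (⟨y, f y⟩ : TangentBundle 𝓘(ℝ, ℂ) ℂ)) (z x) := by
    refine (mdifferentiableAt_section (IB := 𝓘(ℝ, ℂ)) (F := ℂ)
      (E := fun y : ℂ => TangentSpace 𝓘(ℝ, ℂ) y) (s := f)).2 ?_
    simpa using! hf.mdifferentiableAt
  exact MDifferentiableAt.mpullback_vectorField (V := f) hV (contMDiffAt_coord hz hx)
    (isInvertible_mfderiv_coord hz hx) (by simp)

end Coordinates

/-! ### Normal form of a torsion-free special connection -/

section Christoffel

variable {M : Type*} [TopologicalSpace M] [ChartedSpace ℂ M] {z : OpenPartialHomeomorph M ℂ}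

theorem mvfderiv_comp_coord (hz : z ∈ IsManifold.maximalAtlas 𝓘(ℂ) ω M) {x : M}
    (hx : x ∈ z.source) {f : ℂ → ℝ} (hf : DifferentiableAt ℝ f (z x)) (v : RTangent x) :
    MDifferentiableAt 𝓘(ℝ, ℂ) 𝓘(ℝ, ℝ) (fun y => f (z y)) x ∧
    mvfderiv 𝓘(ℝ, ℂ) (fun y => f (z y)) x v = fderiv ℝ f (z x) (coordDiff z x v) := by
  have h1 := ((mdifferentiable_coord hz).mdifferentiableAt hx).hasMFDerivAt
  have h2 := HasMFDerivAt.comp x hf.hasFDerivAt.hasMFDerivAt h1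
  refine ⟨h2.mdifferentiableAt, ?_⟩
  have h3 := h2.mfderiv
  simp only [Function.comp_def] at h3
  rw [mvfderiv, h3]
  rfl

variable [IsManifold 𝓘(ℂ) ω M] {U : Set M}

namespace SpecialKahlerOn

/-- The Christoffel symbol `∇_v u` of the connection in a local coordinate. -/
noncomputable def christoffel (S : SpecialKahlerOn M U) (z : OpenPartialHomeomorph M ℂ) (x : M)
    (v u : ℂ) : ℂ :=
  coordDiff z x (S.conn (coordField z u) x (coordField z v x))

theorem christoffel_add_left (S : SpecialKahlerOn M U) (x : M) (v v' u : ℂ) :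
    S.christoffel z x (v + v') u = S.christoffel z x v u + S.christoffel z x v' u := by
  simp [christoffel, coordField_add]

theorem christoffel_smul_left (S : SpecialKahlerOn M U) (x : M) (r : ℝ) (v u : ℂ) :
    S.christoffel z x (r • v) u = r • S.christoffel z x v u := by
  simp only [christoffel, coordField_smul, Pi.smul_apply, map_smul]

/-- The covariant derivative of a vector field with components `f`. -/
theorem coordDiff_conn_coordField_comp (S : SpecialKahlerOn M U)
    (hz : z ∈ IsManifold.maximalAtlas 𝓘(ℂ) ω M) {x : M} (hx : x ∈ z.source) (hxU : x ∈ U)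
    {f : ℂ → ℂ} (hf : DifferentiableAt ℝ f (z x)) (v : ℂ) :
    coordDiff z x (S.conn (fun y => coordField z (f (z y)) y) x (coordField z v x)) =
      fderiv ℝ f (z x) v + (f (z x)).re • S.christoffel z x v 1 +
        (f (z x)).im • S.christoffel z x v Complex.I := by
  have hre : DifferentiableAt ℝ (fun ζ => (f ζ).re) (z x) :=
    Complex.reCLM.differentiableAt.comp _ hf
  have him : DifferentiableAt ℝ (fun ζ => (f ζ).im) (z x) :=
    Complex.imCLM.differentiableAt.comp _ hf
  obtain ⟨hre1, hre2⟩ := mvfderiv_comp_coord hz hx hre (coordField z v x)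
  obtain ⟨him1, him2⟩ := mvfderiv_comp_coord hz hx him (coordField z v x)
  rw [coordDiff_coordField hz hx] at hre2 him2
  have h1 := (vecSmoothAt_coordField hz hx 1).vecDiffAt
  have hI := (vecSmoothAt_coordField hz hx Complex.I).vecDiffAt
  -- The Leibniz rule applies to real functions, so the field is split along the real frame `∂/∂x`,
  -- `∂/∂y`.
  have hfun : (fun y => coordField z (f (z y)) y) =
      (fun y => (f (z y)).re) • coordField z 1 +
        (fun y => (f (z y)).im) • coordField z Complex.I := by
    funext y
    have : f (z y) = (f (z y)).re • (1 : ℂ) + (f (z y)).im • Complex.I := by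
      rw [Complex.real_smul, Complex.real_smul, mul_one, Complex.re_add_im]
    conv_lhs => rw [this, coordField_add, coordField_smul, coordField_smul]
    rfl
  have hcov := S.conn_isCovariantDerivative
  rw [hfun, hcov.add (MDifferentiableAt.smul_section hre1 h1)
    (MDifferentiableAt.smul_section him1 hI) hxU, hcov.leibniz h1 hre1 hxU,
    hcov.leibniz hI him1 hxU]
  have hfd : fderiv ℝ f (z x) v = (fderiv ℝ (fun ζ => (f ζ).re) (z x) v : ℝ) • (1 : ℂ) +
      (fderiv ℝ (fun ζ => (f ζ).im) (z x) v : ℝ) • Complex.I := by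
    have e1 : fderiv ℝ (fun ζ => (f ζ).re) (z x) = Complex.reCLM ∘L fderiv ℝ f (z x) :=
      (Complex.reCLM.hasFDerivAt.comp (z x) hf.hasFDerivAt).fderiv
    have e2 : fderiv ℝ (fun ζ => (f ζ).im) (z x) = Complex.imCLM ∘L fderiv ℝ f (z x) :=
      (Complex.imCLM.hasFDerivAt.comp (z x) hf.hasFDerivAt).fderiv
    rw [e1, e2]
    simp
  rw [hfd]
  simp only [add_apply, smul_apply, map_add, map_smul,
    ContinuousLinearMap.smulRight_apply, hre2, him2, coordDiff_coordField hz hx]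
  simp only [christoffel]
  ring

theorem christoffel_eq_re_im (S : SpecialKahlerOn M U)
    (hz : z ∈ IsManifold.maximalAtlas 𝓘(ℂ) ω M) {x : M} (hx : x ∈ z.source) (hxU : x ∈ U)
    (v u : ℂ) : S.christoffel z x v u =
      u.re • S.christoffel z x v 1 + u.im • S.christoffel z x v Complex.I := by
  have := S.coordDiff_conn_coordField_comp hz hx hxU (f := fun _ => u)
    (differentiableAt_const _) v
  exact this.trans (by simp)

/-- The connection depends only on the germ of the vector field. -/
theorem conn_congr (S : SpecialKahlerOn M U) (hU : IsOpen U) {x : M} (hxU : x ∈ U)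
    {X Y : (x : M) → RTangent x} (hX : VecDiffAt X x) (h : ∀ᶠ y in 𝓝 x, Y y = X y) :
    S.conn Y x = S.conn X x := by
  have hY : VecDiffAt Y x := by
    refine MDifferentiableAt.congr_of_eventuallyEq hX ?_
    filter_upwards [h] with y hy
    rw [hy]
  exact S.conn_isCovariantDerivative.congr_of_eventuallyEq hY hX (hU.mem_nhds hxU) h

theorem christoffel_comm (S : SpecialKahlerOn M U)
    (hz : z ∈ IsManifold.maximalAtlas 𝓘(ℂ) ω M) {x : M} (hx : x ∈ z.source) (hxU : x ∈ U)
    (v u : ℂ) : S.christoffel z x v u = S.christoffel z x u v := by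
  have h := S.torsion_free x hxU (coordField z v) (coordField z u)
    (vecSmoothAt_coordField hz hx v).vecDiffAt (vecSmoothAt_coordField hz hx u).vecDiffAt
  rw [mlieBracket_coordField hz hx] at h
  have h2 := congrArg (coordDiff z x) h
  rw [map_sub, map_zero, sub_eq_zero] at h2
  exact h2

theorem conn_cxStr_coordField (S : SpecialKahlerOn M U) (hU : IsOpen U)
    (hz : z ∈ IsManifold.maximalAtlas 𝓘(ℂ) ω M) {x : M} (hx : x ∈ z.source) (hxU : x ∈ U)
    (u : ℂ) : S.conn (fun y => cxStr y (coordField z u y)) x =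
      S.conn (coordField z (Complex.I * u)) x := by
  refine S.conn_congr hU hxU (vecSmoothAt_coordField hz hx _).vecDiffAt ?_
  filter_upwards [z.open_source.mem_nhds hx] with y hy
  exact cxStr_coordField hz hy u

/-- This is the symmetry of `(∇_v I) u = ∇_v (I u) - I ∇_v u`: the terms `I ∇_v u` and `I ∇_u v`
cancel by torsion-freeness. -/
theorem christoffel_I_mul (S : SpecialKahlerOn M U) (hU : IsOpen U)
    (hz : z ∈ IsManifold.maximalAtlas 𝓘(ℂ) ω M) {x : M} (hx : x ∈ z.source) (hxU : x ∈ U)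
    (v u : ℂ) : S.christoffel z x v (Complex.I * u) = S.christoffel z x u (Complex.I * v) := by
  have h := S.special x hxU (coordField z v) (coordField z u)
    (vecSmoothAt_coordField hz hx v).vecDiffAt (vecSmoothAt_coordField hz hx u).vecDiffAt
  rw [S.conn_cxStr_coordField hU hz hx hxU, S.conn_cxStr_coordField hU hz hx hxU] at h
  have h2 := congrArg (coordDiff z x) h
  rw [map_sub, map_sub, coordDiff_cxStr hz hx, coordDiff_cxStr hz hx] at h2
  have h3 := S.christoffel_comm hz hx hxU v u
  simp only [christoffel] at h3 ⊢
  rw [h3] at h2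
  exact sub_left_injective h2

/-- The complex linear coefficient of the connection form. -/
noncomputable def connLin (S : SpecialKahlerOn M U) (z : OpenPartialHomeomorph M ℂ) (x : M) : ℂ :=
  (S.christoffel z x 1 1 - Complex.I * S.christoffel z x 1 Complex.I) / 2

/-- The complex antilinear coefficient of the connection form. -/
noncomputable def connConj (S : SpecialKahlerOn M U) (z : OpenPartialHomeomorph M ℂ) (x : M) : ℂ :=
  (S.christoffel z x 1 1 + Complex.I * S.christoffel z x 1 Complex.I) / 2

open ComplexConjugate in
/-- A torsion-free special connection on a Riemann surface is
`∇_v u = ∂_v u + a v u + c v̄ ū`. -/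
theorem christoffel_eq (S : SpecialKahlerOn M U) (hU : IsOpen U)
    (hz : z ∈ IsManifold.maximalAtlas 𝓘(ℂ) ω M) {x : M} (hx : x ∈ z.source) (hxU : x ∈ U)
    (v u : ℂ) : S.christoffel z x v u =
      S.connLin z x * v * u + S.connConj z x * conj v * conj u := by
  have e1 := S.christoffel_eq_re_im hz hx hxU v u
  have e2 : ∀ w : ℂ, S.christoffel z x v w =
      v.re • S.christoffel z x 1 w + v.im • S.christoffel z x Complex.I w := fun w => by
    rw [← christoffel_smul_left, ← christoffel_smul_left, ← christoffel_add_left]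
    congr 1
    rw [Complex.real_smul, Complex.real_smul, mul_one, Complex.re_add_im]
  -- The relations `Γ(i, 1) = Γ(1, i)` and `Γ(i, i) = -Γ(1, 1)` leave two complex parameters and
  -- exclude the mixed terms `v ū` and `v̄ u`.
  have e3 := S.christoffel_comm hz hx hxU Complex.I 1
  have e4 : S.christoffel z x Complex.I Complex.I = -S.christoffel z x 1 1 := by
    have h1 := S.christoffel_I_mul hU hz hx hxU Complex.I 1
    rw [mul_one, Complex.I_mul_I] at h1
    rw [h1, S.christoffel_eq_re_im hz hx hxU 1 (-1)]
    simp
  rw [e2 1, e2 Complex.I, e3, e4] at e1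
  have hv : v = v.re + v.im * Complex.I := (Complex.re_add_im v).symm
  have hu : u = u.re + u.im * Complex.I := (Complex.re_add_im u).symm
  have hvc : conj v = v.re - v.im * Complex.I := by apply Complex.ext <;> simp
  have huc : conj u = u.re - u.im * Complex.I := by apply Complex.ext <;> simp
  rw [e1, hvc, huc, connLin, connConj]
  simp only [Complex.real_smul]
  set p := S.christoffel z x 1 1
  set q := S.christoffel z x 1 Complex.I
  have hI := Complex.I_mul_I
  linear_combination (-(v.im * u.im * p) + (v.re * u.im + v.im * u.re) * q) * hI -
    (p - Complex.I * q) / 2 * u * hv -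
    (p - Complex.I * q) / 2 * (v.re + v.im * Complex.I) * hu

end SpecialKahlerOn

end Christoffel

/-! ### Smoothness of the coefficients and the flatness equations -/

section Curvature

open ComplexConjugate

variable {M : Type*} [TopologicalSpace M] [ChartedSpace ℂ M] [IsManifold 𝓘(ℂ) ω M]
  {z : OpenPartialHomeomorph M ℂ} {U : Set M}

namespace SpecialKahlerOn

/-- Smoothness of `∇` is stated for fields smooth on all of `U`, whereas a coordinate field is
controlled only on the domain of `z`. A bump function equal to one near the point corrects this, and
locality of `∇` removes it again. -/
theorem contDiffAt_christoffel [T2Space M] (S : SpecialKahlerOn M U) (hU : IsOpen U)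
    (hz : z ∈ IsManifold.maximalAtlas 𝓘(ℂ) ω M) {ζ : ℂ} (hζ : ζ ∈ z.target)
    (hζU : z.symm ζ ∈ U) (v u : ℂ) :
    ContDiffAt ℝ ∞ (fun η => S.christoffel z (z.symm η) v u) ζ := by
  have hx : z.symm ζ ∈ z.source := z.map_target hζ
  obtain ⟨ψ, -, hψ⟩ := (SmoothBumpFunction.nhds_basis_tsupport (I := 𝓘(ℝ, ℂ))
    (z.symm ζ)).mem_iff.1 (z.open_source.mem_nhds hx)
  have hσ : ContMDiff 𝓘(ℝ, ℂ) (𝓘(ℝ, ℂ).prod 𝓘(ℝ, ℂ)) ∞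
      (fun y => (⟨y, ((ψ : M → ℝ) • coordField z u) y⟩ : TangentBundle 𝓘(ℝ, ℂ) M)) :=
    ContMDiffOn.smul_section_of_tsupport ψ.contMDiff.contMDiffOn z.open_source hψ
      (fun y hy => (vecSmoothAt_coordField hz hy u).contMDiffWithinAt)
  have hconn := (S.conn_smooth.contMDiff (σ := (ψ : M → ℝ) • coordField z u)
    hσ.contMDiffOn).contMDiffAt (hU.mem_nhds hζU)
  have happ : VecSmoothAt (fun y => S.conn ((ψ : M → ℝ) • coordField z u) y (coordField z v y))
      (z.symm ζ) :=
    ContMDiffAt.clm_bundle_apply hconn (vecSmoothAt_coordField hz hx v)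
  refine (contDiffAt_coordDiff_comp_symm hz hζ happ).congr_of_eventuallyEq ?_
  have hnear : ∀ᶠ y in 𝓝 (z.symm ζ), y ∈ U ∧ y ∈ z.source ∧ ∀ᶠ y' in 𝓝 y,
      ((ψ : M → ℝ) • coordField z u) y' = coordField z u y' := by
    refine (hU.eventually_mem hζU).and ((z.open_source.eventually_mem hx).and ?_)
    rw [eventually_eventually_nhds]
    filter_upwards [ψ.eventuallyEq_one] with y hy
    simp [hy]
  filter_upwards [(z.symm.continuousAt hζ).eventually hnear] with η hη
  rw [S.conn_congr hU hη.1 (vecSmoothAt_coordField hz hη.2.1 u).vecDiffAt hη.2.2]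
  rfl

theorem contDiffAt_connLin [T2Space M] (S : SpecialKahlerOn M U) (hU : IsOpen U)
    (hz : z ∈ IsManifold.maximalAtlas 𝓘(ℂ) ω M) {ζ : ℂ} (hζ : ζ ∈ z.target)
    (hζU : z.symm ζ ∈ U) : ContDiffAt ℝ ∞ (fun η => S.connLin z (z.symm η)) ζ := by
  unfold connLin
  exact ((S.contDiffAt_christoffel hU hz hζ hζU 1 1).sub
    (contDiffAt_const.mul (S.contDiffAt_christoffel hU hz hζ hζU 1 Complex.I))).div_const 2

theorem contDiffAt_connConj [T2Space M] (S : SpecialKahlerOn M U) (hU : IsOpen U)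
    (hz : z ∈ IsManifold.maximalAtlas 𝓘(ℂ) ω M) {ζ : ℂ} (hζ : ζ ∈ z.target)
    (hζU : z.symm ζ ∈ U) : ContDiffAt ℝ ∞ (fun η => S.connConj z (z.symm η)) ζ := by
  unfold connConj
  exact ((S.contDiffAt_christoffel hU hz hζ hζU 1 1).add
    (contDiffAt_const.mul (S.contDiffAt_christoffel hU hz hζ hζU 1 Complex.I))).div_const 2

/-- The second covariant derivative of a coordinate vector field. -/
theorem coordDiff_conn_conn_coordField [T2Space M] (S : SpecialKahlerOn M U) (hU : IsOpen U)
    (hz : z ∈ IsManifold.maximalAtlas 𝓘(ℂ) ω M) {ζ : ℂ} (hζ : ζ ∈ z.target)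
    (hζU : z.symm ζ ∈ U) (v v' u : ℂ) :
    coordDiff z (z.symm ζ) (S.conn (fun y => S.conn (coordField z u) y (coordField z v' y))
        (z.symm ζ) (coordField z v (z.symm ζ))) =
      fderiv ℝ (fun η => S.christoffel z (z.symm η) v' u) ζ v +
        S.christoffel z (z.symm ζ) v (S.christoffel z (z.symm ζ) v' u) := by
  have hx : z.symm ζ ∈ z.source := z.map_target hζ
  have hζx : z (z.symm ζ) = ζ := z.right_inv hζ
  have hf : DifferentiableAt ℝ (fun η => S.christoffel z (z.symm η) v' u) (z (z.symm ζ)) := by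
    rw [hζx]
    exact (S.contDiffAt_christoffel hU hz hζ hζU v' u).differentiableAt (by simp)
  -- Near the point the inner derivative is the field with components `Γ(v', u)`, to which the
  -- component formula applies.
  have hcongr : S.conn (fun y => S.conn (coordField z u) y (coordField z v' y)) (z.symm ζ) =
      S.conn (fun y => coordField z (S.christoffel z (z.symm (z y)) v' u) y) (z.symm ζ) := by
    refine S.conn_congr hU hζU (vecDiffAt_coordField_comp hz hx hf) ?_
    filter_upwards [z.open_source.mem_nhds hx] with y hy
    rw [z.left_inv hy, christoffel, coordField_coordDiff hz hy]
  rw [hcongr, S.coordDiff_conn_coordField_comp hz hx hζU hf, hζx,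
    S.christoffel_eq_re_im hz hx hζU v (S.christoffel z (z.symm ζ) v' u), add_assoc]

theorem flat_christoffel [T2Space M] (S : SpecialKahlerOn M U) (hU : IsOpen U)
    (hz : z ∈ IsManifold.maximalAtlas 𝓘(ℂ) ω M) {ζ : ℂ} (hζ : ζ ∈ z.target)
    (hζU : z.symm ζ ∈ U) (v v' u : ℂ) :
    fderiv ℝ (fun η => S.christoffel z (z.symm η) v' u) ζ v +
        S.christoffel z (z.symm ζ) v (S.christoffel z (z.symm ζ) v' u) =
      fderiv ℝ (fun η => S.christoffel z (z.symm η) v u) ζ v' +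
        S.christoffel z (z.symm ζ) v' (S.christoffel z (z.symm ζ) v u) := by
  have hx : z.symm ζ ∈ z.source := z.map_target hζ
  have h := S.flat _ hζU (coordField z v) (coordField z v') (coordField z u)
    (vecSmoothAt_coordField hz hx v) (vecSmoothAt_coordField hz hx v')
    (vecSmoothAt_coordField hz hx u)
  rw [mlieBracket_coordField hz hx, map_zero, sub_eq_zero] at h
  have h2 := congrArg (coordDiff z (z.symm ζ)) h
  rwa [S.coordDiff_conn_conn_coordField hU hz hζ hζU,
    S.coordDiff_conn_conn_coordField hU hz hζ hζU] at h2

theorem fderiv_christoffel [T2Space M] (S : SpecialKahlerOn M U) (hU : IsOpen U)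
    (hz : z ∈ IsManifold.maximalAtlas 𝓘(ℂ) ω M) {ζ : ℂ} (hζ : ζ ∈ z.target)
    (hζU : z.symm ζ ∈ U) (v u w : ℂ) :
    fderiv ℝ (fun η => S.christoffel z (z.symm η) v u) ζ w =
      fderiv ℝ (fun η => S.connLin z (z.symm η)) ζ w * (v * u) +
        fderiv ℝ (fun η => S.connConj z (z.symm η)) ζ w * (conj v * conj u) := by
  have hx : z.symm ζ ∈ z.source := z.map_target hζ
  have h1 := ((S.contDiffAt_connLin hU hz hζ hζU).differentiableAt (by simp)).hasFDerivAt
  have h2 := ((S.contDiffAt_connConj hU hz hζ hζU).differentiableAt (by simp)).hasFDerivAt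
  have h3 := (h1.mul_const (v * u)).add (h2.mul_const (conj v * conj u))
  have h4 : (fun η => S.christoffel z (z.symm η) v u) =ᶠ[𝓝 ζ] fun η =>
      S.connLin z (z.symm η) * (v * u) + S.connConj z (z.symm η) * (conj v * conj u) := by
    filter_upwards [z.open_target.mem_nhds hζ,
      (z.symm.continuousAt hζ).eventually (hU.mem_nhds hζU)] with η hη hηU
    rw [S.christoffel_eq hU hz (z.map_target hη) hηU]
    ring
  rw [(h3.congr_of_eventuallyEq h4).fderiv]
  simp
  ring

/-- Evaluating the curvature of the pair `(1, i)` on `1` and on `i` separates its complex linear and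
antilinear parts: `∂̄a = -|c|²` and `∂c = -a c`. -/
theorem fderiv_connLin [T2Space M] (S : SpecialKahlerOn M U) (hU : IsOpen U)
    (hz : z ∈ IsManifold.maximalAtlas 𝓘(ℂ) ω M) {ζ : ℂ} (hζ : ζ ∈ z.target)
    (hζU : z.symm ζ ∈ U) :
    (fderiv ℝ (fun η => S.connLin z (z.symm η)) ζ 1 +
      Complex.I * fderiv ℝ (fun η => S.connLin z (z.symm η)) ζ Complex.I =
      -2 * (S.connConj z (z.symm ζ) * conj (S.connConj z (z.symm ζ)))) ∧
    (fderiv ℝ (fun η => S.connConj z (z.symm η)) ζ 1 -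
      Complex.I * fderiv ℝ (fun η => S.connConj z (z.symm η)) ζ Complex.I =
      -2 * (S.connLin z (z.symm ζ) * S.connConj z (z.symm ζ))) := by
  have hx : z.symm ζ ∈ z.source := z.map_target hζ
  have e1 := S.flat_christoffel hU hz hζ hζU 1 Complex.I 1
  have e2 := S.flat_christoffel hU hz hζ hζU 1 Complex.I Complex.I
  simp only [S.fderiv_christoffel hU hz hζ hζU, S.christoffel_eq hU hz hx hζU, map_one, map_add,
    map_mul, map_neg, Complex.conj_I, mul_one, one_mul] at e1 e2
  set a := S.connLin z (z.symm ζ)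
  set c := S.connConj z (z.symm ζ)
  set a1 := fderiv ℝ (fun η => S.connLin z (z.symm η)) ζ 1
  set aI := fderiv ℝ (fun η => S.connLin z (z.symm η)) ζ Complex.I
  set c1 := fderiv ℝ (fun η => S.connConj z (z.symm η)) ζ 1
  set cI := fderiv ℝ (fun η => S.connConj z (z.symm η)) ζ Complex.I
  have hI := Complex.I_mul_I
  constructor
  · linear_combination (-Complex.I / 2) * e1 - (1 / 2) * e2 +
      (a1 + 2 * (c * conj c)) * hI
  · linear_combination (Complex.I / 2) * e1 - (1 / 2) * e2 + (c1 + 2 * (a * c)) * hI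

end SpecialKahlerOn

end Curvature

/-! ### The conformal factor and the cubic form in terms of the connection -/

section Metric

open ComplexConjugate

theorem mvfderiv_congr_of_eventuallyEq {M : Type*} [TopologicalSpace M] [ChartedSpace ℂ M]
    {f g : M → ℝ} {x : M} (h : f =ᶠ[𝓝 x] g)
    (v : RTangent x) : mvfderiv 𝓘(ℝ, ℂ) f x v = mvfderiv 𝓘(ℝ, ℂ) g x v :=
  congrArg (fun L : ℂ →L[ℝ] ℝ => L v) h.mfderiv_eq

variable {M : Type*} [TopologicalSpace M] [ChartedSpace ℂ M] [IsManifold 𝓘(ℂ) ω M]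
  {z : OpenPartialHomeomorph M ℂ} {U : Set M}

namespace SpecialKahlerOn

theorem metric_coordField (S : SpecialKahlerOn M U)
    (hz : z ∈ IsManifold.maximalAtlas 𝓘(ℂ) ω M) {x : M} (hx : x ∈ z.source) (hxU : x ∈ U)
    (u v : ℂ) : S.metric x (coordField z u x) (coordField z v x) =
      S.metric x (coordField z 1 x) (coordField z 1 x) * (u * conj v).re := by
  have hexp : ∀ w : ℂ, coordField z w x =
      w.re • coordField z 1 x + w.im • coordField z Complex.I x := by
    intro w
    have : w = w.re • (1 : ℂ) + w.im • Complex.I := by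
      rw [Complex.real_smul, Complex.real_smul, mul_one, Complex.re_add_im]
    conv_lhs => rw [this, coordField_add, coordField_smul, coordField_smul]
    rfl
  have hI : cxStr x (coordField z 1 x) = coordField z Complex.I x := by
    rw [cxStr_coordField hz hx, mul_one]
  have hII : cxStr x (coordField z Complex.I x) = -coordField z 1 x := by
    rw [cxStr_coordField hz hx, Complex.I_mul_I, hexp (-1)]
    simp
  have e1 : S.metric x (coordField z Complex.I x) (coordField z Complex.I x) =
      S.metric x (coordField z 1 x) (coordField z 1 x) := by
    rw [← hI, S.metric_hermitian x hxU]
  have e2 : S.metric x (coordField z 1 x) (coordField z Complex.I x) = 0 := by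
    have h1 := S.metric_hermitian x hxU (coordField z 1 x) (coordField z Complex.I x)
    rw [hI, hII, map_neg, S.metric_symm x hxU] at h1
    linarith
  have e3 : S.metric x (coordField z Complex.I x) (coordField z 1 x) = 0 := by
    rw [S.metric_symm x hxU, e2]
  rw [hexp u, hexp v]
  simp only [map_add, map_smul, add_apply, smul_apply, e1, e2, e3, smul_eq_mul]
  simp
  ring

theorem conformalFactor_pos (S : SpecialKahlerOn M U)
    (hz : z ∈ IsManifold.maximalAtlas 𝓘(ℂ) ω M) {ζ : ℂ} (hζ : ζ ∈ z.target)
    (hζU : z.symm ζ ∈ U) : 0 < S.conformalFactor z ζ := by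
  refine S.metric_pos _ hζU _ fun h => ?_
  have := coordDiff_coordField hz (z.map_target hζ) 1
  rw [h, map_zero] at this
  exact zero_ne_one this

theorem contDiffAt_conformalFactor (S : SpecialKahlerOn M U) (hU : IsOpen U)
    (hz : z ∈ IsManifold.maximalAtlas 𝓘(ℂ) ω M) {ζ : ℂ} (hζ : ζ ∈ z.target)
    (hζU : z.symm ζ ∈ U) : ContDiffAt ℝ ∞ (S.conformalFactor z) ζ := by
  have hx : z.symm ζ ∈ z.source := z.map_target hζ
  have h1 := S.metric_smooth.contMDiffAt (hU.mem_nhds hζU)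
  have h2 := vecSmoothAt_coordField hz hx 1
  have h3 : ContMDiffAt 𝓘(ℝ, ℂ) (𝓘(ℝ, ℂ).prod 𝓘(ℝ, ℝ)) ∞
      (fun y => Bundle.TotalSpace.mk' ℝ (E := Bundle.Trivial M ℝ) y
        (S.metric y (coordField z 1 y) (coordField z 1 y))) (z.symm ζ) :=
    ContMDiffAt.clm_bundle_apply₂ (F₁ := ℂ) (F₂ := ℂ) h1 h2 h2
  simp only [Bundle.contMDiffAt_totalSpace] at h3
  exact (h3.2.comp ζ ((contMDiffAt_coord_symm hz hζ).of_le le_top)).contDiffAt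

theorem conformalFactor_coord (S : SpecialKahlerOn M U) {x : M} (hx : x ∈ z.source) :
    S.conformalFactor z (z x) = S.metric x (coordField z 1 x) (coordField z 1 x) := by
  rw [conformalFactor, z.left_inv hx]

theorem conn_coordField_coordField (S : SpecialKahlerOn M U)
    (hz : z ∈ IsManifold.maximalAtlas 𝓘(ℂ) ω M) {x : M} (hx : x ∈ z.source) (v u : ℂ) :
    S.conn (coordField z u) x (coordField z v x) = coordField z (S.christoffel z x v u) x := by
  rw [christoffel, coordField_coordDiff hz hx]

/-- Since `w = ω(∂/∂x, ∂/∂y)`, `∇ω = 0` makes `dw / w` the trace of the connection form. The map `u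
↦ a v u` has real trace `2 Re (a v)`, and the antilinear part is trace-free. -/
theorem fderiv_conformalFactor (S : SpecialKahlerOn M U) (hU : IsOpen U)
    (hz : z ∈ IsManifold.maximalAtlas 𝓘(ℂ) ω M) {ζ : ℂ} (hζ : ζ ∈ z.target)
    (hζU : z.symm ζ ∈ U) (v : ℂ) : fderiv ℝ (S.conformalFactor z) ζ v =
      2 * (S.connLin z (z.symm ζ) * v).re * S.conformalFactor z ζ := by
  have hx : z.symm ζ ∈ z.source := z.map_target hζ
  have hζx : z (z.symm ζ) = ζ := z.right_inv hζ
  have h := S.symplectic _ hζU (coordField z 1) (coordField z Complex.I)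
    (vecSmoothAt_coordField hz hx 1).vecDiffAt (vecSmoothAt_coordField hz hx _).vecDiffAt
    (coordField z v (z.symm ζ))
  have hev : (fun y => S.metric y (cxStr y (coordField z 1 y)) (coordField z Complex.I y))
      =ᶠ[𝓝 (z.symm ζ)] fun y => S.conformalFactor z (z y) := by
    filter_upwards [z.open_source.mem_nhds hx, hU.mem_nhds hζU] with y hy hyU
    rw [S.conformalFactor_coord hy, cxStr_coordField hz hy, mul_one, S.metric_coordField hz hy hyU]
    simp
  have hd := (mvfderiv_comp_coord hz hx (f := S.conformalFactor z) (by
    rw [hζx]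
    exact (S.contDiffAt_conformalFactor hU hz hζ hζU).differentiableAt (by simp))
    (coordField z v (z.symm ζ))).2
  rw [mvfderiv_congr_of_eventuallyEq hev, hd, coordDiff_coordField hz hx, hζx,
    S.conn_coordField_coordField hz hx, S.conn_coordField_coordField hz hx,
    cxStr_coordField hz hx, cxStr_coordField hz hx, S.metric_coordField hz hx hζU (_ * _) _,
    S.metric_coordField hz hx hζU (Complex.I * 1) _, S.christoffel_eq hU hz hx hζU,
    S.christoffel_eq hU hz hx hζU] at h
  rw [h, conformalFactor]
  simp
  ring

/-- The projection is built from `I`, so its covariant derivative sees only the part of the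
connection form that does not commute with `I`, namely `c`. -/
theorem cubicCoeff_eq (S : SpecialKahlerOn M U) (hU : IsOpen U)
    (hz : z ∈ IsManifold.maximalAtlas 𝓘(ℂ) ω M) {ζ : ℂ} (hζ : ζ ∈ z.target)
    (hζU : z.symm ζ ∈ U) : S.cubicCoeff z ζ =
      -(Complex.I * conj (S.connConj z (z.symm ζ)) * (S.conformalFactor z ζ / 2 : ℝ)) := by
  have hx : z.symm ζ ∈ z.source := z.map_target hζ
  set x := z.symm ζ with hxd
  have h1 := (vecSmoothAt_coordField hz hx 1).vecDiffAt
  have hI1 : VecDiffAt (fun y => cxStr y (coordField z 1 y)) x := by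
    refine MDifferentiableAt.congr_of_eventuallyEq
      (vecSmoothAt_coordField hz hx Complex.I).vecDiffAt ?_
    filter_upwards [z.open_source.mem_nhds hx] with y hy
    rw [cxStr_coordField hz hy, mul_one]
  have hc1 : S.conn (fun y => (piOneZero y (coordField z 1 y)).1) x (coordField z 1 x) =
      (1 / 2 : ℝ) • S.conn (coordField z 1) x (coordField z 1 x) := by
    have := S.conn_isCovariantDerivative.smul_const (1 / 2 : ℝ) h1 hζU
    exact congrArg (fun L : ℂ →L[ℝ] ℂ => L (coordField z 1 x)) this
  have hc2 : S.conn (fun y => (piOneZero y (coordField z 1 y)).2) x (coordField z 1 x) =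
      (-1 / 2 : ℝ) • S.conn (coordField z Complex.I) x (coordField z 1 x) := by
    have := S.conn_isCovariantDerivative.smul_const (-1 / 2 : ℝ) hI1 hζU
    rw [S.conn_cxStr_coordField hU hz hx hζU, mul_one] at this
    exact congrArg (fun L : ℂ →L[ℝ] ℂ => L (coordField z 1 x)) this
  have hcov : S.covPiOneZero (coordField z 1) (coordField z 1) x =
      (0, coordField z (Complex.I * S.connConj z x) x) := by
    rw [covPiOneZero, hc1, hc2, piOneZero]
    refine Prod.ext ?_ ?_
    · exact sub_self _
    · apply coordDiff_injective hz hx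
      simp only [Prod.snd_sub, map_sub, map_smul, coordDiff_cxStr hz hx,
        coordDiff_coordField hz hx, S.conn_coordField_coordField hz hx]
      rw [S.christoffel_eq hU hz hx hζU, S.christoffel_eq hU hz hx hζU]
      simp
      ring
  rw [cubicCoeff, cubicForm, hcov, piOneZero, kahlerFormC]
  have hI : cxStr x (coordField z 1 x) = coordField z (Complex.I * 1) x := cxStr_coordField hz hx 1
  have hII := cxStr_coordField hz hx (Complex.I * 1)
  simp only [map_smul, smul_apply, map_zero, smul_eq_mul]
  rw [hI, hII, S.metric_coordField hz hx hζU (Complex.I * 1),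
    S.metric_coordField hz hx hζU (Complex.I * (Complex.I * 1)), conformalFactor, ← hxd]
  apply Complex.ext <;> simp <;> ring

/-- This is how the order of `Ξ` and the growth of `w` control the antilinear part of the
connection. -/
theorem norm_connConj_eq (S : SpecialKahlerOn M U) (hU : IsOpen U)
    (hz : z ∈ IsManifold.maximalAtlas 𝓘(ℂ) ω M) {ζ : ℂ} (hζ : ζ ∈ z.target)
    (hζU : z.symm ζ ∈ U) :
    ‖S.connConj z (z.symm ζ)‖ = 2 * ‖S.cubicCoeff z ζ‖ / S.conformalFactor z ζ := by
  have hw := S.conformalFactor_pos hz hζ hζU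
  rw [S.cubicCoeff_eq hU hz hζ hζU, norm_neg, norm_mul, norm_mul, Complex.norm_I, one_mul,
    RCLike.norm_conj, Complex.norm_real, Real.norm_of_nonneg (by positivity)]
  field_simp

theorem connForm_mulVec (S : SpecialKahlerOn M U)
    (hz : z ∈ IsManifold.maximalAtlas 𝓘(ℂ) ω M) {ζ : ℂ} (hζ : ζ ∈ z.target)
    (hζU : z.symm ζ ∈ U) (v : ℂ) (V : Fin 2 → ℝ) :
    S.connForm z ζ v *ᵥ V =
      ![(S.christoffel z (z.symm ζ) v (V 0 + V 1 * Complex.I)).re,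
        (S.christoffel z (z.symm ζ) v (V 0 + V 1 * Complex.I)).im] := by
  rw [S.christoffel_eq_re_im hz (z.map_target hζ) hζU v (V 0 + V 1 * Complex.I)]
  have hform : ∀ i j, S.connForm z ζ v i j =
      Complex.basisOneI.repr (S.christoffel z (z.symm ζ) v (Complex.basisOneI j)) i :=
    fun i j => rfl
  ext i
  fin_cases i <;>
    simp [Matrix.mulVec, dotProduct, Fin.sum_univ_two, hform, Complex.coe_basisOneI_repr,
      Complex.coe_basisOneI] <;> ring

end SpecialKahlerOn
end Metric

/-! ### Pullback to the logarithmic coordinate -/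

section LogPullback

open ComplexConjugate

/-- For `L v = α v + β v̄` both sides are `2 β ζ̄`; in the next lemma they are `2 α ζ`. These are
the chain rules for `∂̄` and `∂` under the exponential, whose derivative is multiplication by `ζ`.
-/
theorem map_mul_add_I_mul_map (L : ℂ →L[ℝ] ℂ) (ζ : ℂ) :
    L ζ + Complex.I * L (Complex.I * ζ) = conj ζ * (L 1 + Complex.I * L Complex.I) := by
  rw [← conjLin_coeff L]
  simp only [conjLin_apply, map_mul, map_one, Complex.conj_I]
  linear_combination (linCoeff L * (ζ - conj ζ)) * Complex.I_sq

theorem map_mul_sub_I_mul_map (L : ℂ →L[ℝ] ℂ) (ζ : ℂ) :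
    L ζ - Complex.I * L (Complex.I * ζ) = ζ * (L 1 - Complex.I * L Complex.I) := by
  rw [← conjLin_coeff L]
  simp only [conjLin_apply, map_mul, map_one, Complex.conj_I]
  linear_combination (conjCoeff L * (conj ζ - ζ)) * Complex.I_sq

theorem hasFDerivAt_mul_exp (p σ : ℂ) :
    HasFDerivAt (𝕜 := ℝ) (fun σ => p * Complex.exp σ)
      ((p * Complex.exp σ) • ContinuousLinearMap.id ℝ ℂ) σ := by
  have h := ((Complex.hasDerivAt_exp σ).const_mul p).hasFDerivAt.restrictScalars ℝ
  convert! h using 1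
  ext
  simp [mul_comm]

theorem mul_exp_add_two_pi (p σ : ℂ) :
    p * Complex.exp (σ + 2 * Real.pi * Complex.I) = p * Complex.exp σ := by
  rw [Complex.exp_add, Complex.exp_two_pi_mul_I, mul_one]

theorem norm_mul_exp (p σ : ℂ) : ‖p * Complex.exp σ‖ = ‖p‖ * Real.exp σ.re := by
  rw [norm_mul, Complex.norm_exp]

theorem norm_mul_exp_lt {p σ : ℂ} (hp : p ≠ 0) {R : ℝ} (hR : 0 < R)
    (hσ : σ.re < Real.log (R / ‖p‖)) : ‖p * Complex.exp σ‖ < R := by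
  have hp' := norm_pos_iff.2 hp
  rw [norm_mul_exp, mul_comm, ← lt_div_iff₀ hp', ← Real.lt_log_iff_exp_lt (by positivity)]
  exact hσ

/-- Transfers asymptotics at the puncture to `Re σ → -∞`, uniformly in the angle. -/
theorem tendsto_mul_exp {p : ℂ} (hp : p ≠ 0) :
    Tendsto (fun σ => p * Complex.exp σ) (comap Complex.re atBot) (𝓝[≠] 0) := by
  refine tendsto_nhdsWithin_iff.2 ⟨?_, Eventually.of_forall fun σ =>
    mul_ne_zero hp (Complex.exp_ne_zero σ)⟩
  rw [← tendsto_zero_iff_norm_tendsto_zero.symm]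
  simp only [norm_mul_exp]
  simpa using (Real.tendsto_exp_atBot.comp tendsto_comap).const_mul ‖p‖

/-- The pullback of flat special connection coefficients on a punctured disc under
`σ ↦ p * exp σ`. -/
theorem isFlatStrip_comp_exp {a c : ℂ → ℂ} {p : ℂ} (hp : p ≠ 0) {R : ℝ} (hR : 0 < R)
    (ha : ∀ ζ, ζ ≠ 0 → ‖ζ‖ < R → ContDiffAt ℝ 1 a ζ)
    (hc : ∀ ζ, ζ ≠ 0 → ‖ζ‖ < R → ContDiffAt ℝ 1 c ζ)
    (hlin : ∀ ζ, ζ ≠ 0 → ‖ζ‖ < R →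
      fderiv ℝ a ζ 1 + Complex.I * fderiv ℝ a ζ Complex.I = -2 * (c ζ * conj (c ζ)))
    (hconj : ∀ ζ, ζ ≠ 0 → ‖ζ‖ < R →
      fderiv ℝ c ζ 1 - Complex.I * fderiv ℝ c ζ Complex.I = -2 * (a ζ * c ζ)) :
    IsFlatStrip (Real.log (R / ‖p‖))
      (fun σ => a (p * Complex.exp σ) * (p * Complex.exp σ))
      (fun σ => c (p * Complex.exp σ) * conj (p * Complex.exp σ)) := by
  have hne : ∀ σ, p * Complex.exp σ ≠ 0 := fun σ => mul_ne_zero hp (Complex.exp_ne_zero σ)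
  have hexp : ContDiff ℝ 1 fun σ => p * Complex.exp σ :=
    contDiff_const.mul (Complex.contDiff_exp (𝕜 := ℝ))
  have hd : ∀ {f : ℂ → ℂ}, (∀ ζ, ζ ≠ 0 → ‖ζ‖ < R → ContDiffAt ℝ 1 f ζ) → ∀ σ : ℂ,
      σ.re < Real.log (R / ‖p‖) → HasFDerivAt (fun σ => f (p * Complex.exp σ))
        ((fderiv ℝ f (p * Complex.exp σ)).comp
          ((p * Complex.exp σ) • ContinuousLinearMap.id ℝ ℂ)) σ := fun hf σ hσ =>
    HasFDerivAt.comp σ ((hf _ (hne σ) (norm_mul_exp_lt hp hR hσ)).differentiableAt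
      one_ne_zero).hasFDerivAt (hasFDerivAt_mul_exp p σ)
  refine ⟨fun σ hσ => ?_, fun σ hσ => ?_, fun σ hσ => ?_, fun σ hσ => ?_, fun σ => ?_,
    fun σ => ?_⟩
  · exact (((ha _ (hne σ) (norm_mul_exp_lt hp hR hσ)).comp σ hexp.contDiffAt).mul
      hexp.contDiffAt).contDiffWithinAt
  · exact (((hc _ (hne σ) (norm_mul_exp_lt hp hR hσ)).comp σ hexp.contDiffAt).mul
      (Complex.conjCLE.contDiff.comp hexp).contDiffAt).contDiffWithinAt
  -- The factor `p e^σ` is holomorphic, so `∂̄` acts on `a` alone; in the next bullet the conjugate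
  -- factor is annihilated by `∂` in the same way.
  · have h := (hd ha σ hσ).fun_mul (hasFDerivAt_mul_exp p σ)
    have e := hlin _ (hne σ) (norm_mul_exp_lt hp hR hσ)
    have e' := map_mul_add_I_mul_map (fderiv ℝ a (p * Complex.exp σ)) (p * Complex.exp σ)
    rw [h.fderiv]
    generalize p * Complex.exp σ = ζ at *
    simp only [add_apply, smul_apply, ContinuousLinearMap.comp_apply,
      ContinuousLinearMap.id_apply, smul_eq_mul, mul_one, map_mul, Complex.conj_conj]
    rw [mul_comm ζ Complex.I]
    linear_combination ζ * e' + ζ * conj ζ * e + a ζ * ζ * Complex.I_sq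
  · have hcj : HasFDerivAt (fun σ => conj (p * Complex.exp σ)) _ σ :=
      (Complex.conjCLE : ℂ →L[ℝ] ℂ).hasFDerivAt.comp σ (hasFDerivAt_mul_exp p σ)
    have h := (hd hc σ hσ).fun_mul hcj
    have e := hconj _ (hne σ) (norm_mul_exp_lt hp hR hσ)
    have e' := map_mul_sub_I_mul_map (fderiv ℝ c (p * Complex.exp σ)) (p * Complex.exp σ)
    rw [h.fderiv]
    generalize p * Complex.exp σ = ζ at *
    simp [-mul_eq_mul_left_iff]
    rw [mul_comm ζ Complex.I]
    linear_combination conj ζ * e' + ζ * conj ζ * e + c ζ * conj ζ * Complex.I_sq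
  · simp only [mul_exp_add_two_pi]
  · simp only [mul_exp_add_two_pi]

end LogPullback

/-! ### Logarithmic growth rates -/

section Asymptotics

/-- Logarithmic growth rate of a function that is asymptotic to a power, up to a factor whose
logarithm is negligible. -/
theorem tendsto_log_div_log {w ρ : ℂ → ℝ} {β C : ℝ} (hC : 0 < C)
    (hρ : ∀ᶠ ζ in 𝓝[≠] (0 : ℂ), 0 < ρ ζ)
    (hρl : Tendsto (fun ζ => Real.log (ρ ζ) / Real.log ‖ζ‖) (𝓝[≠] 0) (𝓝 0))
    (h : Tendsto (fun ζ => w ζ / (‖ζ‖ ^ β * ρ ζ)) (𝓝[≠] 0) (𝓝 C)) :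
    Tendsto (fun ζ => Real.log (w ζ) / Real.log ‖ζ‖) (𝓝[≠] 0) (𝓝 β) := by
  have hlog : Tendsto (fun ζ : ℂ => Real.log ‖ζ‖) (𝓝[≠] 0) atBot :=
    Real.tendsto_log_nhdsGT_zero.comp tendsto_norm_nhdsNE_zero
  have h1 : Tendsto (fun ζ => Real.log (w ζ / (‖ζ‖ ^ β * ρ ζ)) / Real.log ‖ζ‖) (𝓝[≠] 0) (𝓝 0) :=
    (h.log hC.ne').div_atBot hlog
  have h2 := (h1.add hρl).const_add β
  rw [add_zero, add_zero] at h2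
  refine h2.congr' ?_
  filter_upwards [hρ, h.eventually_ne hC.ne', self_mem_nhdsWithin,
    hlog.eventually_lt_atBot 0] with ζ h1 h2 h3 h4
  have hζ : 0 < ‖ζ‖ := norm_pos_iff.2 h3
  have h5 := h4.ne
  have hw : w ζ ≠ 0 := fun h0 => h2 (by rw [h0, zero_div])
  have hpow : 0 < ‖ζ‖ ^ β := Real.rpow_pos_of_pos hζ β
  rw [Real.log_div hw (by positivity), Real.log_mul hpow.ne' h1.ne', Real.log_rpow hζ]
  field_simp
  ring

/-- In the logarithmic case the extra factor `-log r` does not change the growth exponent. -/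
theorem tendsto_log_neg_log_div_log :
    Tendsto (fun ζ : ℂ => Real.log (-Real.log ‖ζ‖) / Real.log ‖ζ‖) (𝓝[≠] 0) (𝓝 0) := by
  have hlog : Tendsto (fun ζ : ℂ => -Real.log ‖ζ‖) (𝓝[≠] 0) atTop :=
    tendsto_neg_atBot_atTop.comp (Real.tendsto_log_nhdsGT_zero.comp tendsto_norm_nhdsNE_zero)
  have h := (Real.isLittleO_log_id_atTop.tendsto_div_nhds_zero.comp hlog).neg
  rw [neg_zero] at h
  refine h.congr fun ζ => ?_
  simp [div_neg]

end Asymptotics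

/-! ### The connection near the puncture -/

section Puncture

open ComplexConjugate

theorem exists_ball_subset_target {M : Type*} [TopologicalSpace M]
    (z : OpenPartialHomeomorph M ℂ) {r : ℝ} (hr : 0 ≤ r)
    (h : Metric.closedBall 0 r ⊆ z.target) : ∃ R, r < R ∧ Metric.ball 0 R ⊆ z.target := by
  obtain ⟨δ, hδ, h'⟩ := (isCompact_closedBall (0 : ℂ) r).exists_thickening_subset_open
    z.open_target h
  rw [thickening_closedBall hδ hr] at h'
  exact ⟨δ + r, by linarith, h'⟩

theorem symm_mem_compl_singleton {M : Type*} [TopologicalSpace M]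
    {z : OpenPartialHomeomorph M ℂ} {m₀ : M} (hz₀ : z m₀ = 0) {ζ : ℂ} (hζ : ζ ∈ z.target)
    (h0 : ζ ≠ 0) : z.symm ζ ∈ ({m₀}ᶜ : Set M) := by
  intro h
  rw [mem_singleton_iff] at h
  exact h0 (by rw [← z.right_inv hζ, h, hz₀])

theorem eventually_mem_target {M : Type*} [TopologicalSpace M]
    {z : OpenPartialHomeomorph M ℂ} {m₀ : M} (hm₀ : m₀ ∈ z.source) (hz₀ : z m₀ = 0) :
    ∀ᶠ ζ in 𝓝[≠] (0 : ℂ), ζ ≠ 0 ∧ ζ ∈ z.target ∧ z.symm ζ ∈ ({m₀}ᶜ : Set M) := by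
  have h0 : (0 : ℂ) ∈ z.target := hz₀ ▸ z.map_source hm₀
  filter_upwards [self_mem_nhdsWithin, mem_nhdsWithin_of_mem_nhds (z.open_target.mem_nhds h0)]
    with ζ h1 h2
  exact ⟨h1, h2, symm_mem_compl_singleton hz₀ h2 h1⟩

variable {M : Type*} [TopologicalSpace M] [ChartedSpace ℂ M] [IsManifold 𝓘(ℂ) ω M]
  {z : OpenPartialHomeomorph M ℂ} {m₀ : M}

namespace SpecialKahlerOn

theorem HasCubicOrder.exists_norm_le {S : SpecialKahlerOn M {m₀}ᶜ} {n : ℤ}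
    (hn : S.HasCubicOrder z n) :
    ∃ K, 0 < K ∧ ∀ᶠ ζ in 𝓝[≠] (0 : ℂ), ‖S.cubicCoeff z ζ‖ ≤ K * ‖ζ‖ ^ n := by
  obtain ⟨g, hg, -, hfg⟩ := (meromorphicOrderAt_eq_int_iff hn.1).1 hn.2
  refine ⟨‖g 0‖ + 1, by positivity, ?_⟩
  have hb := hg.continuousAt.norm.eventually_lt continuousAt_const (lt_add_one ‖g 0‖)
  filter_upwards [hfg, mem_nhdsWithin_of_mem_nhds hb] with ζ h1 h2
  rw [h1, sub_zero, norm_smul, norm_zpow, mul_comm]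
  exact mul_le_mul_of_nonneg_right h2.le (by positivity)

/-- Were both to hold, the conical quotient would be the logarithmic one times `-log r`, which is
unbounded. This excludes the logarithmic alternative once the singularity is assumed conical. -/
theorem IsConicalAt.not_isLogarithmicAt {S : SpecialKahlerOn M {m₀}ᶜ} {n : ℤ}
    (h : S.IsConicalAt z n) : ¬ S.IsLogarithmicAt z n := by
  rintro ⟨C', hC', h'⟩
  obtain ⟨C, hC, h⟩ := h
  have hlog : Tendsto (fun ζ : ℂ => -Real.log ‖ζ‖) (𝓝[≠] 0) atTop :=
    tendsto_neg_atBot_atTop.comp (Real.tendsto_log_nhdsGT_zero.comp tendsto_norm_nhdsNE_zero)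
  refine not_tendsto_nhds_of_tendsto_atTop (h'.pos_mul_atTop hC' hlog) C (h.congr' ?_)
  filter_upwards [self_mem_nhdsWithin, hlog.eventually_gt_atTop 0] with ζ h1 h2
  have hζ : 0 < ‖ζ‖ := norm_pos_iff.2 h1
  have hl : Real.log ‖ζ‖ ≠ 0 := by
    intro h0
    simp [h0] at h2
  rw [Real.rpow_intCast]
  field_simp

variable [T2Space M]

theorem isFlatStrip (S : SpecialKahlerOn M {m₀}ᶜ) (hz : z ∈ IsManifold.maximalAtlas 𝓘(ℂ) ω M)
    (hz₀ : z m₀ = 0) {R : ℝ} (hR : 0 < R)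
    (hball : Metric.ball 0 R ⊆ z.target) {p : ℂ} (hp : p ≠ 0) :
    IsFlatStrip (Real.log (R / ‖p‖))
      (fun σ => S.connLin z (z.symm (p * Complex.exp σ)) * (p * Complex.exp σ))
      (fun σ => S.connConj z (z.symm (p * Complex.exp σ)) * conj (p * Complex.exp σ)) := by
  have hU : IsOpen ({m₀}ᶜ : Set M) := isOpen_compl_singleton
  have ht : ∀ ζ : ℂ, ‖ζ‖ < R → ζ ∈ z.target := fun ζ h => hball (by simpa using h)
  have hm : ∀ ζ : ℂ, ζ ≠ 0 → ‖ζ‖ < R → z.symm ζ ∈ ({m₀}ᶜ : Set M) := fun ζ h0 h =>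
    symm_mem_compl_singleton hz₀ (ht ζ h) h0
  exact isFlatStrip_comp_exp (a := fun ζ => S.connLin z (z.symm ζ))
    (c := fun ζ => S.connConj z (z.symm ζ)) hp hR
    (fun ζ h0 h => (S.contDiffAt_connLin hU hz (ht ζ h) (hm ζ h0 h)).of_le (by simp))
    (fun ζ h0 h => (S.contDiffAt_connConj hU hz (ht ζ h) (hm ζ h0 h)).of_le (by simp))
    (fun ζ h0 h => (S.fderiv_connLin hU hz (ht ζ h) (hm ζ h0 h)).1)
    (fun ζ h0 h => (S.fderiv_connLin hU hz (ht ζ h) (hm ζ h0 h)).2)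

/-- Halving `log w` removes the factor `2` in `dw = 2 Re (a v) w`, which gives the potential `l`
required by `IsFlatStrip.tendsto_integral_lin`. -/
theorem hasFDerivAt_log_conformalFactor (S : SpecialKahlerOn M {m₀}ᶜ)
    (hz : z ∈ IsManifold.maximalAtlas 𝓘(ℂ) ω M)
    (hz₀ : z m₀ = 0) {p σ : ℂ} (hp : p ≠ 0)
    (hσ : p * Complex.exp σ ∈ z.target) :
    ∃ L : ℂ →L[ℝ] ℝ,
      HasFDerivAt (fun σ => Real.log (S.conformalFactor z (p * Complex.exp σ)) / 2) L σ ∧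
      ∀ v, L v =
        (S.connLin z (z.symm (p * Complex.exp σ)) * (p * Complex.exp σ) * v).re := by
  have hU : IsOpen ({m₀}ᶜ : Set M) := isOpen_compl_singleton
  have hm := symm_mem_compl_singleton hz₀ hσ (mul_ne_zero hp (Complex.exp_ne_zero σ))
  have hw := S.conformalFactor_pos hz hσ hm
  have h1 := ((S.contDiffAt_conformalFactor hU hz hσ hm).differentiableAt (by simp)).hasFDerivAt
  have h2 : HasFDerivAt (fun σ => S.conformalFactor z (p * Complex.exp σ)) _ σ :=
    HasFDerivAt.comp (g := S.conformalFactor z) σ h1 (hasFDerivAt_mul_exp p σ)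
  refine ⟨_, (h2.log hw.ne').mul_const (2⁻¹ : ℝ), fun v => ?_⟩
  simp only [smul_apply, ContinuousLinearMap.comp_apply, ContinuousLinearMap.id_apply,
    smul_eq_mul, S.fderiv_conformalFactor hU hz hσ hm]
  rw [mul_assoc (S.connLin z _)]
  field_simp

/-- The conjugate-linear part of the connection in the logarithmic coordinate. -/
theorem exists_norm_connConj_mul_le (S : SpecialKahlerOn M {m₀}ᶜ)
    (hz : z ∈ IsManifold.maximalAtlas 𝓘(ℂ) ω M)
    (hm₀ : m₀ ∈ z.source) (hz₀ : z m₀ = 0) {n : ℤ} (hn : S.HasCubicOrder z n)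
    {ρ : ℂ → ℝ} {β C : ℝ} (hC : 0 < C) (hρ : ∀ᶠ ζ in 𝓝[≠] (0 : ℂ), 0 < ρ ζ)
    (h : Tendsto (fun ζ => S.conformalFactor z ζ / (‖ζ‖ ^ β * ρ ζ)) (𝓝[≠] 0) (𝓝 C)) :
    ∃ K, 0 < K ∧ ∀ᶠ ζ in 𝓝[≠] (0 : ℂ),
      ‖S.connConj z (z.symm ζ)‖ * ‖ζ‖ ≤ K * (‖ζ‖ ^ (n + 1 - β) / ρ ζ) := by
  obtain ⟨K, hK, hΞ⟩ := hn.exists_norm_le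
  -- A factor `2` comes from `norm_connConj_eq`, another from the lower bound `C / 2` for the
  -- quotient tending to `C`.
  refine ⟨4 * K / C, by positivity, ?_⟩
  filter_upwards [hΞ, hρ, h.eventually_const_le (half_lt_self hC),
    eventually_mem_target hm₀ hz₀] with ζ h1 h2 h3 ⟨h4, h5, h6⟩
  have hζ : 0 < ‖ζ‖ := norm_pos_iff.2 h4
  have hpow : 0 < ‖ζ‖ ^ β := Real.rpow_pos_of_pos hζ β
  have hw := S.conformalFactor_pos hz h5 h6
  rw [le_div_iff₀ (by positivity)] at h3
  rw [S.norm_connConj_eq isOpen_compl_singleton hz h5 h6, Real.rpow_sub hζ, Real.rpow_add hζ,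
    Real.rpow_one, Real.rpow_intCast]
  calc 2 * ‖S.cubicCoeff z ζ‖ / S.conformalFactor z ζ * ‖ζ‖
      ≤ 2 * (K * ‖ζ‖ ^ n) / (C / 2 * (‖ζ‖ ^ β * ρ ζ)) * ‖ζ‖ := by gcongr
    _ = 4 * K / C * (‖ζ‖ ^ n * ‖ζ‖ / ‖ζ‖ ^ β / ρ ζ) := by
        field_simp
        ring

end SpecialKahlerOn

end Puncture

/-! ### Holonomy matrices and transport in the logarithmic coordinate -/

section Holonomy

open ComplexConjugate

/-- The matrix of a real-linear endomorphism of `ℂ` in the basis `1, i`. -/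
noncomputable def conjMatrix (T : ℂ →L[ℝ] ℂ) : Matrix (Fin 2) (Fin 2) ℝ :=
  !![(T 1).re, (T Complex.I).re; (T 1).im, (T Complex.I).im]

theorem conjMatrix_mulVec (T : ℂ →L[ℝ] ℂ) (V : Fin 2 → ℝ) :
    conjMatrix T *ᵥ V = ![(T (V 0 + V 1 * Complex.I)).re, (T (V 0 + V 1 * Complex.I)).im] := by
  have h : T (V 0 + V 1 * Complex.I) = V 0 • T 1 + V 1 • T Complex.I := by
    rw [← map_smul, ← map_smul, ← map_add]
    simp
  rw [h]
  ext i
  fin_cases i <;> simp [conjMatrix, Matrix.mulVec, dotProduct, Fin.sum_univ_two] <;> ring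

theorem trace_conjMatrix (T : ℂ →L[ℝ] ℂ) : (conjMatrix T).trace = 2 * (linCoeff T).re := by
  conv_lhs => rw [← conjLin_coeff T]
  simp [conjMatrix, Matrix.trace_fin_two, conjLin_apply]
  ring

theorem det_conjMatrix (T : ℂ →L[ℝ] ℂ) :
    (conjMatrix T).det = Complex.normSq (linCoeff T) - Complex.normSq (conjCoeff T) := by
  conv_lhs => rw [← conjLin_coeff T]
  simp [conjMatrix, Matrix.det_fin_two, conjLin_apply, Complex.normSq_apply]
  ring

theorem conjMatrix_eq_of_real {T : ℂ →L[ℝ] ℂ} (h1 : (linCoeff T).im = 0) (h2 : conjCoeff T = 0) :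
    conjMatrix T = !![(linCoeff T).re, 0; 0, (linCoeff T).re] := by
  conv_lhs => rw [← conjLin_coeff T]
  simp [conjMatrix, conjLin_apply, h1, h2]

variable {M : Type*} [TopologicalSpace M] [T2Space M] [ChartedSpace ℂ M] [IsManifold 𝓘(ℂ) ω M]
  {z : OpenPartialHomeomorph M ℂ} {m₀ : M}

namespace SpecialKahlerOn

/-- The circle through `p` is the line `s = 0`, and its velocity `i p e^{it}` is `i ζ`; the factor
`i` gives the signs in `IsFlatStrip.angular`. -/
theorem isParallelAlongCircle_iff (S : SpecialKahlerOn M {m₀}ᶜ)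
    (hz : z ∈ IsManifold.maximalAtlas 𝓘(ℂ) ω M) (hz₀ : z m₀ = 0) {p : ℂ} (hp : p ≠ 0)
    (hdisc : Metric.closedBall 0 ‖p‖ ⊆ z.target) {V : ℝ → Fin 2 → ℝ} :
    S.IsParallelAlongCircle z p V ↔ ∀ t, HasDerivAt (fun t => (V t 0 + V t 1 * Complex.I : ℂ))
      (-(IsFlatStrip.angular
        (fun σ => S.connLin z (z.symm (p * Complex.exp σ)) * (p * Complex.exp σ))
        (fun σ => S.connConj z (z.symm (p * Complex.exp σ)) * conj (p * Complex.exp σ)) 0 t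
        (V t 0 + V t 1 * Complex.I))) t := by
  refine forall_congr' fun t => ?_
  have hne : p * Complex.exp (t * Complex.I) ≠ 0 := mul_ne_zero hp (Complex.exp_ne_zero _)
  have ht : p * Complex.exp (t * Complex.I) ∈ z.target :=
    hdisc (by simp [Complex.norm_exp])
  have hm := symm_mem_compl_singleton hz₀ ht hne
  have hang : IsFlatStrip.angular
      (fun σ => S.connLin z (z.symm (p * Complex.exp σ)) * (p * Complex.exp σ))
      (fun σ => S.connConj z (z.symm (p * Complex.exp σ)) * conj (p * Complex.exp σ)) 0 t
      (V t 0 + V t 1 * Complex.I) =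
      S.christoffel z (z.symm (p * Complex.exp (t * Complex.I)))
        (Complex.I * p * Complex.exp (t * Complex.I)) (V t 0 + V t 1 * Complex.I) := by
    rw [S.christoffel_eq isOpen_compl_singleton hz (z.map_target ht) hm, IsFlatStrip.angular,
      conjLin_apply]
    simp only [logCoord, Complex.ofReal_zero, zero_add, map_mul, Complex.conj_I]
    ring
  rw [hang, S.connForm_mulVec hz ht hm]
  generalize S.christoffel z (z.symm (p * Complex.exp (t * Complex.I)))
    (Complex.I * p * Complex.exp (t * Complex.I)) (V t 0 + V t 1 * Complex.I) = Γ
  rw [hasDerivAt_pi]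
  simp only [Fin.forall_fin_two]
  constructor
  · rintro ⟨h0, h1⟩
    convert! h0.ofReal_comp.add (h1.ofReal_comp.mul_const Complex.I) using 1
    apply Complex.ext <;> simp
  · intro h
    constructor
    · have := Complex.reCLM.hasFDerivAt.comp_hasDerivAt t h
      simpa [Function.comp_def] using this
    · have := Complex.imCLM.hasFDerivAt.comp_hasDerivAt t h
      simpa [Function.comp_def] using this

theorem isCircleHolonomy_conjMatrix (S : SpecialKahlerOn M {m₀}ᶜ)
    (hz : z ∈ IsManifold.maximalAtlas 𝓘(ℂ) ω M) (hz₀ : z m₀ = 0) {p : ℂ} (hp : p ≠ 0)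
    (hdisc : Metric.closedBall 0 ‖p‖ ⊆ z.target) {R : ℝ}
    (h : IsFlatStrip R
      (fun σ => S.connLin z (z.symm (p * Complex.exp σ)) * (p * Complex.exp σ))
      (fun σ => S.connConj z (z.symm (p * Complex.exp σ)) * conj (p * Complex.exp σ)))
    (hR : 0 < R) {Φ : ℝ → ℂ →L[ℝ] ℂ} (hΦ0 : Φ 0 = 1)
    (hΦ : ∀ t, HasDerivAt Φ (-(IsFlatStrip.angular
      (fun σ => S.connLin z (z.symm (p * Complex.exp σ)) * (p * Complex.exp σ))
      (fun σ => S.connConj z (z.symm (p * Complex.exp σ)) * conj (p * Complex.exp σ)) 0 t *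
        Φ t)) t) :
    S.IsCircleHolonomy z p (conjMatrix (Φ (2 * Real.pi))) := by
  have hu : ∀ u : ℂ, ∀ t, HasDerivAt (fun t => Φ t u) _ t := fun u t =>
    (hΦ t).clm_apply (hasDerivAt_const t u)
  have hre : ∀ u : ℂ, (u.re + u.im * Complex.I : ℂ) = u := Complex.re_add_im
  refine ⟨fun v => ⟨fun t => ![(Φ t (v 0 + v 1 * Complex.I)).re,
    (Φ t (v 0 + v 1 * Complex.I)).im], ?_, ?_⟩, fun V hV => ?_⟩
  · rw [S.isParallelAlongCircle_iff hz hz₀ hp hdisc]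
    intro t
    simp only [Matrix.cons_val_zero, Matrix.cons_val_one, hre]
    convert! hu (v 0 + v 1 * Complex.I) t using 1
    simp
  · simp only [hΦ0]
    ext i
    fin_cases i <;> simp
  · rw [S.isParallelAlongCircle_iff hz hz₀ hp hdisc] at hV
    obtain ⟨K, -, hK⟩ := (h.periodic_angular 0).exists_norm_le Real.two_pi_pos
      (h.continuous_angular hR)
    have huniq := eq_of_hasDerivAt_linear (u := fun t => (V t 0 + V t 1 * Complex.I : ℂ))
      (v := fun t => Φ t (V 0 0 + V 0 1 * Complex.I)) (K := K)
      (A := fun t => -(IsFlatStrip.angular _ _ 0 t)) (fun t => by rw [norm_neg]; exact hK t)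
      (fun t => by simpa using hV t)
      (fun t => by
        convert! hu (V 0 0 + V 0 1 * Complex.I) t using 1
        simp) (by simp [hΦ0])
    have h2 : (V (2 * Real.pi) 0 + V (2 * Real.pi) 1 * Complex.I : ℂ) = _ :=
      congrFun huniq (2 * Real.pi)
    rw [conjMatrix_mulVec, ← h2]
    ext i
    fin_cases i <;> simp

end SpecialKahlerOn

end Holonomy

/-! ### Trace, determinant and rigidity of the holonomy around the puncture -/

section HolonomyAroundPuncture

open ComplexConjugate

theorem log_norm_mul_exp {p : ℂ} (hp : p ≠ 0) (σ : ℂ) :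
    Real.log ‖p * Complex.exp σ‖ = Real.log ‖p‖ + σ.re := by
  rw [norm_mul_exp, Real.log_mul (norm_ne_zero_iff.2 hp) (Real.exp_ne_zero _), Real.log_exp]

theorem tendsto_log_comp_exp_div_re {w : ℂ → ℝ} {β : ℝ} {p : ℂ} (hp : p ≠ 0)
    (h : Tendsto (fun ζ => Real.log (w ζ) / Real.log ‖ζ‖) (𝓝[≠] 0) (𝓝 β)) :
    Tendsto (fun σ => Real.log (w (p * Complex.exp σ)) / 2 / σ.re) (comap Complex.re atBot)
      (𝓝 (β / 2)) := by
  have hre : Tendsto Complex.re (comap Complex.re atBot) atBot := tendsto_comap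
  have h1 : Tendsto (fun σ : ℂ => Real.log ‖p‖ / σ.re + 1) (comap Complex.re atBot) (𝓝 1) := by
    simpa using (tendsto_const_nhds.div_atBot hre).add_const (1 : ℝ)
  have h2 := ((h.comp (tendsto_mul_exp hp)).mul h1).div_const 2
  rw [mul_one] at h2
  refine h2.congr' ?_
  filter_upwards [hre.eventually_lt_atBot 0, hre.eventually_lt_atBot (-Real.log ‖p‖)] with σ h3 h4
  have h5 : Real.log ‖p‖ + σ.re ≠ 0 := by linarith
  have h6 := h3.ne
  simp only [Function.comp_apply, log_norm_mul_exp hp]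
  field_simp

variable {M : Type*} [TopologicalSpace M] [ChartedSpace ℂ M] [IsManifold 𝓘(ℂ) ω M]
  {z : OpenPartialHomeomorph M ℂ} {m₀ : M}

namespace SpecialKahlerOn

/-- Conical and logarithmic singularities have conformal factor comparable to `‖ζ‖ ^ β * ρ` with
`ρ` of subpolynomial growth. -/
theorem exists_tendsto_conformalFactor_div (S : SpecialKahlerOn M {m₀}ᶜ) {n : ℤ} {β : ℝ}
    (hβ : (β < n + 1 ∧ S.IsConicalAt z β) ∨ (β = n + 1 ∧ S.IsLogarithmicAt z (n + 1))) :
    ∃ (ρ : ℂ → ℝ) (C : ℝ), 0 < C ∧ (∀ᶠ ζ in 𝓝[≠] (0 : ℂ), 0 < ρ ζ) ∧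
      Tendsto (fun ζ => Real.log (ρ ζ) / Real.log ‖ζ‖) (𝓝[≠] 0) (𝓝 0) ∧
      Tendsto (fun ζ => S.conformalFactor z ζ / (‖ζ‖ ^ β * ρ ζ)) (𝓝[≠] 0) (𝓝 C) ∧
      Tendsto (fun ζ => ‖ζ‖ ^ (n + 1 - β) / ρ ζ) (𝓝[≠] 0) (𝓝 0) := by
  have hlog : Tendsto (fun ζ : ℂ => -Real.log ‖ζ‖) (𝓝[≠] 0) atTop :=
    tendsto_neg_atBot_atTop.comp (Real.tendsto_log_nhdsGT_zero.comp tendsto_norm_nhdsNE_zero)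
  rcases hβ with ⟨hlt, C, hC, h⟩ | ⟨rfl, C, hC, h⟩
  · refine ⟨fun _ => 1, C, hC, Eventually.of_forall fun _ => one_pos, by simp, by simpa using h, ?_⟩
    have hδ : 0 < n + 1 - β := by linarith
    have hnorm : Tendsto (fun ζ : ℂ => ‖ζ‖) (𝓝[≠] 0) (𝓝 0) :=
      tendsto_norm_zero.mono_left nhdsWithin_le_nhds
    have h2 := hnorm.rpow_const (p := n + 1 - β)
      (Or.inr hδ.le)
    simpa [Real.zero_rpow hδ.ne'] using h2
  -- Here `n + 1 - β = 0`, so the decay of the last quotient comes entirely from `1 / (-log r)`.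
  · refine ⟨fun ζ => -Real.log ‖ζ‖, C, hC, hlog.eventually_gt_atTop 0,
      tendsto_log_neg_log_div_log, h.congr fun ζ => ?_, ?_⟩
    · rw [← mul_neg, ← Real.rpow_intCast]
      push_cast
      rfl
    · refine hlog.inv_tendsto_atTop.congr fun ζ => ?_
      simp

variable [T2Space M]

theorem exists_conjMatrix_holonomy (S : SpecialKahlerOn M {m₀}ᶜ)
    (hz : z ∈ IsManifold.maximalAtlas 𝓘(ℂ) ω M) (hm₀ : m₀ ∈ z.source) (hz₀ : z m₀ = 0)
    {n : ℤ} (hn : S.HasCubicOrder z n) {β : ℝ}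
    (hβ : (β < n + 1 ∧ S.IsConicalAt z β) ∨ (β = n + 1 ∧ S.IsLogarithmicAt z (n + 1)))
    {p : ℂ} (hp : p ≠ 0) (hdisc : Metric.closedBall 0 ‖p‖ ⊆ z.target) :
    ∃ T : ℂ →L[ℝ] ℂ, S.IsCircleHolonomy z p (conjMatrix T) ∧
      (linCoeff T).re = Real.cos (Real.pi * β) ∧
      Complex.normSq (linCoeff T) - Complex.normSq (conjCoeff T) = 1 ∧
      (S.IsConicalAt z β → Real.sin (Real.pi * β) = 0 →
        (linCoeff T).im = 0 ∧ conjCoeff T = 0) := by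
  obtain ⟨R, hR, hball⟩ := exists_ball_subset_target z (norm_nonneg p) hdisc
  have hp' := norm_pos_iff.2 hp
  have hR0 : 0 < R := hp'.trans hR
  -- The coordinate extends slightly beyond the closed disc, so `s = 0`, the circle through `p`,
  -- lies inside the open strip.
  have hS : 0 < Real.log (R / ‖p‖) := Real.log_pos ((one_lt_div hp').2 hR)
  have hstrip := S.isFlatStrip hz hz₀ hR0 hball hp
  have hhol := fun (Φ : ℝ → ℂ →L[ℝ] ℂ) =>
    S.isCircleHolonomy_conjMatrix hz hz₀ hp hdisc hstrip hS (Φ := Φ)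
  have hl := fun σ : ℂ => fun hσ : σ.re < Real.log (R / ‖p‖) =>
    S.hasFDerivAt_log_conformalFactor hz hz₀ hp (σ := σ)
      (hball (by simpa using norm_mul_exp_lt hp hR0 hσ))
  obtain ⟨ρ, C, hC, hρ, hρl, hw, hδ⟩ := S.exists_tendsto_conformalFactor_div hβ
  obtain ⟨K, hK, hb⟩ := S.exists_norm_connConj_mul_le hz hm₀ hz₀ hn hC hρ hw
  have hlb := tendsto_log_comp_exp_div_re hp (tendsto_log_div_log hC hρ hρl hw)
  have hb0 : Tendsto
      (fun σ => S.connConj z (z.symm (p * Complex.exp σ)) * conj (p * Complex.exp σ))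
      (comap Complex.re atBot) (𝓝 0) := by
    have h := hδ.const_mul K
    rw [mul_zero] at h
    refine squeeze_zero_norm' ?_ (h.comp (tendsto_mul_exp hp))
    filter_upwards [(tendsto_mul_exp hp).eventually hb] with σ h1
    rwa [norm_mul, RCLike.norm_conj]
  -- With `ρ = 1` the power bound `‖ζ‖ ^ (n + 1 - β)` becomes exponential decay in `Re σ` at the
  -- positive rate `n + 1 - β`.
  have hbexp : S.IsConicalAt z β → ∃ K δ s₀ : ℝ, 0 < δ ∧ ∀ σ : ℂ, σ.re < s₀ →
      ‖S.connConj z (z.symm (p * Complex.exp σ)) * conj (p * Complex.exp σ)‖ ≤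
        K * Real.exp (δ * σ.re) := by
    intro hcon
    rcases hβ with ⟨hlt, -⟩ | ⟨rfl, hlog⟩
    · obtain ⟨C', hC', hw'⟩ := hcon
      obtain ⟨K', hK', hb'⟩ := S.exists_norm_connConj_mul_le hz hm₀ hz₀ hn (ρ := fun _ => 1) hC'
        (Eventually.of_forall fun _ => one_pos) (by simpa using hw')
      have := (tendsto_mul_exp hp).eventually hb'
      rw [eventually_comap] at this
      obtain ⟨s₀, hs₀⟩ := eventually_atBot.1 this
      refine ⟨K' * ‖p‖ ^ (n + 1 - β), n + 1 - β, s₀, by linarith, fun σ hσ => ?_⟩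
      have h1 := hs₀ σ.re hσ.le σ rfl
      rw [div_one, norm_mul_exp, Real.mul_rpow hp'.le (Real.exp_nonneg _), ← Real.exp_mul,
        mul_comm σ.re] at h1
      rw [norm_mul, RCLike.norm_conj, norm_mul_exp]
      linarith
    · refine absurd hlog (IsConicalAt.not_isLogarithmicAt ?_)
      simpa using hcon
  have hint := hstrip.tendsto_integral_lin hl (fun σ => by simp only [mul_exp_add_two_pi]) hlb
  choose! Φ hΦ using fun s => fun hs : s < Real.log (R / ‖p‖) => hstrip.exists_transport hs
  have hΦ0 := fun s hs => (hΦ s hs).1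
  have hΦd := fun s hs => (hΦ s hs).2
  obtain ⟨h1, h2⟩ := hstrip.tendsto_coeff_holonomy hΦ0 hΦd hb0 hint
  refine ⟨Φ 0 (2 * Real.pi), hhol _ (hΦ0 0 hS) (hΦd 0 hS), hstrip.linCoeff_re_eq hΦ0 hΦd h1 hS,
    hstrip.normSq_linCoeff_sub_eq hΦ0 hΦd h1 h2 hS, fun hcon hsin => ?_⟩
  obtain ⟨K, δ, s₀, hδ, hK⟩ := hbexp hcon
  exact hstrip.holonomy_eq_of_sin_eq_zero hΦ0 hΦd h1 h2 hsin hδ hK hS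

end SpecialKahlerOn

end HolonomyAroundPuncture

/-! ### The holonomy theorem -/

theorem corollary1p2 {M : Type*} [TopologicalSpace M] [T2Space M] [ChartedSpace ℂ M]
    [IsManifold 𝓘(ℂ) ω M] (m₀ : M) (S : SpecialKahlerOn M {m₀}ᶜ)
    (z : OpenPartialHomeomorph M ℂ) (hz : z ∈ IsManifold.maximalAtlas 𝓘(ℂ) ω M)
    (hm₀ : m₀ ∈ z.source) (hz₀ : z m₀ = 0)
    (n : ℤ) (hn : S.HasCubicOrder z n)
    (β : ℝ)
    (hβ : (β < n + 1 ∧ S.IsConicalAt z β) ∨ (β = n + 1 ∧ S.IsLogarithmicAt z (n + 1)))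
    (p : ℂ) (hp : p ≠ 0) (hdisc : Metric.closedBall 0 ‖p‖ ⊆ z.target) :
    ∃ A : Matrix (Fin 2) (Fin 2) ℝ, S.IsCircleHolonomy z p A ∧
      ((∀ k : ℤ, β ≠ k) →
        IsConj A !![Real.cos (Real.pi * β), -Real.sin (Real.pi * β);
                    Real.sin (Real.pi * β), Real.cos (Real.pi * β)]) ∧
      ((∃ k : ℤ, β = 2 * k) → A = 1 ∨ IsConj A !![1, 1; 0, 1]) ∧
      ((∃ k : ℤ, β = 2 * k + 1) → A = -1 ∨ IsConj A !![-1, 1; 0, -1]) ∧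
      (S.IsConicalAt z β → (∃ k : ℤ, β = 2 * k) → A = 1) ∧
      (S.IsConicalAt z β → (∃ k : ℤ, β = 2 * k + 1) → A = -1) := by
  obtain ⟨T, hT, hre, hsq, hcon⟩ := S.exists_conjMatrix_holonomy hz hm₀ hz₀ hn hβ hp hdisc
  have htr := trace_conjMatrix T
  have hdet := (det_conjMatrix T).trans hsq
  rw [hre] at htr
  have hone : (1 : Matrix (Fin 2) (Fin 2) ℝ) = !![1, 0; 0, 1] := Matrix.one_fin_two
  have hneg : (-1 : Matrix (Fin 2) (Fin 2) ℝ) = !![-1, 0; 0, -1] := by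
    rw [hone]
    ext i j
    fin_cases i <;> fin_cases j <;> simp
  have heven : ∀ k : ℤ, β = 2 * k → Real.cos (Real.pi * β) = 1 ∧ Real.sin (Real.pi * β) = 0 := by
    rintro k rfl
    have : Real.pi * (2 * k) = k * (2 * Real.pi) := by ring
    rw [this]
    exact ⟨Real.cos_int_mul_two_pi k, by simpa using Real.sin_add_int_mul_two_pi 0 k⟩
  have hodd : ∀ k : ℤ, β = 2 * k + 1 →
      Real.cos (Real.pi * β) = -1 ∧ Real.sin (Real.pi * β) = 0 := by
    rintro k rfl
    have : Real.pi * (2 * k + 1) = Real.pi + k * (2 * Real.pi) := by ring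
    rw [this, Real.cos_add_int_mul_two_pi, Real.sin_add_int_mul_two_pi]
    simp
  refine ⟨_, hT, fun hβk => ?_, ?_, ?_, ?_, ?_⟩
  · refine isConj_rotation_of_trace_of_det htr hdet fun h => ?_
    obtain ⟨k, hk⟩ := Real.sin_eq_zero_iff.1 h
    exact hβk k (mul_left_cancel₀ Real.pi_ne_zero (by linarith))
  · rintro ⟨k, hk⟩
    rw [(heven k hk).1] at htr
    rw [hone]
    exact eq_or_isConj_of_trace_of_det (by norm_num) htr hdet
  · rintro ⟨k, hk⟩
    rw [(hodd k hk).1] at htr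
    rw [hneg]
    exact eq_or_isConj_of_trace_of_det (by norm_num) htr hdet
  · rintro hc ⟨k, hk⟩
    obtain ⟨h1, h2⟩ := hcon hc (heven k hk).2
    rw [conjMatrix_eq_of_real h1 h2, hre, (heven k hk).1, hone]
  · rintro hc ⟨k, hk⟩
    obtain ⟨h1, h2⟩ := hcon hc (hodd k hk).2
    rw [conjMatrix_eq_of_real h1 h2, hre, (hodd k hk).1, hneg]
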